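/- Let $m,n\ge 0$ be integers, $y\in\mathbb{R}^m$ and $\lambda>0$. For $D\in\mathbb{R}^{m\times n}$ with rows $D_1,\dots,D_m$ (seen as column vectors of $\mathbb{R}^n$) and $z\in\mathbb{R}^n$ let $f(z,D)=\frac12\|Dz-y\|_2^2$ and $F(z,D)=f(z,D)+\lambda\|z\|_1$, and for every $D$ let $z^*(D)$ be a minimizer of $F(\cdot,D)$. Write $S^*=S^*(D)=\{i: z^*(D)_i\ne 0\}$. For a step size $1/L$, $L>0$, which is held fixed when differentiating in $D$, the ISTA iterates are $z_0=0$, $z_{N+1}=ST_{\lambda/L}\big(z_N-\frac1L D^\top(Dz_N-y)\big)$, where $ST_\mu(x)=\mathrm{sgn}(x)(|x|-\mu)_+$ coordinatewise. For a map $u$ from (an open subset $U$ of) $\mathbb{R}^{m\times n}$ to $\mathbb{R}^n$, the weak Jacobian $\frac{\partial u}{\partial D_l}$ is the $n\times n$ matrix of the weak partial derivatives $\partial u_i/\partial D_{lk}$ on $U$ (locally integrable, defined by integration against $C_c^\infty(U)$ test functions). Put $M_l(z,D)=D_lz^\top+(D_l^\top z-y_l)I_n$. **1. Recursion.** For all $L>0$,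 $N\ge 0$ and $l$, $z_N$ has a weak Jacobian $J_l^N=\frac{\partial z_N}{\partial D_l}$ on $\mathbb{R}^{m\times n}$, and for almost every $D$ $$J_l^{N+1}=\mathbb{1}_{|z_{N+1}|>0}\odot\Big(J_l^N-\tfrac1L\big(D_lz_N^\top+(D_l^\top z_N-y_l)I_n+D^\top D\,J_l^N\big)\Big),$$ where $\mathbb 1\odot$ multiplies the $i$-th row by the $i$-th indicator. More precisely, the matrices defined for every $D$ by $J_l^0=0$ and this recursion are a weak Jacobian of $z_N$; denote by $\hat J_l^N(D)$ this representative. **2. Weak Jacobian of the Lasso solution.** Let $\Omega$ be the interior of the set of all $D$ for which $F(\cdot,D)$ has exactly one minimizer. Then almost every $D$ lies in $\Omega$. Whenever the minimizer is unique, $D_{:,S^*}^\top D_{:,S^*}$ is invertible. On $\Omega$ the weak Jacobian of $z^*$ relatively to $D_l$ is the matrix $J_l^*$ with $$(J_l^*)_{S^*}=-(D_{:,S^*}^\top D_{:,S^*})^{-1}\big(D_l{z^*}^\top+(D_l^\top z^*-y_l)I_n\big)_{S^*}$$ in the rows with index in $S^*$, and $0$ in the other rows. **3. Convergence.** For every $L>0$,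 every $l$ and all weak Jacobians $J_l^N$ of $z_N$: for almost every $D$ with $\|D\|^2\le L$ (spectral norm), $J_l^N(D)\to J_l^*(D)$ as $N\to\infty$. Moreover, for almost every $D$, $\hat J_l^N(D)\to J_l^*(D)$ for all $l$ and every $L>0$ with $L\ge\|D\|^2$, in particular for $L=\|D\|^2$ if $D\neq 0$. The latter convergence also holds at each individual $D$ such that $D_{:,S^*}^\top D_{:,S^*}$ is invertible and $|(D^\top(y-Dz^*))_j|<\lambda$ for all $j\notin S^*$. **4. Residual.** For $J=(J_l)_l$, seen as a linear operator $\mathbb{R}^{m\times n}\to\mathbb{R}^n$ with adjoint $J^+$, and $S\subset\{1,\dots,n\}$, let $R(J,S)=J^+\big(\nabla^2_{1,1}f(z^*,D)\odot\mathbb{1}_S\big)+\nabla^2_{2,1}f(z^*,D)\odot\mathbb{1}_S:\mathbb{R}^n\to\mathbb{R}^{m\times n}$, where $\odot\mathbb{1}_S$ sets to zero the columns (input coordinates) with index outside $S$. Then $R(J^*,S^*)=0$ for every $D$ such that $D_{:,S^*}^\top D_{:,S^*}$ is invertible. -/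

import Mathlib

open MeasureTheory Filter Topology
open scoped Matrix ContDiff

noncomputable section

/-- Dictionaries `D ∈ ℝ^{m × n}`; `D l` is the `l`-th row, `D l k` the entry `D_{lk}`.  As a
function space it carries the product (Lebesgue) measure `volume`. -/
abbrev Dict (m n : ℕ) : Type := Fin m → Fin n → ℝ

/-- The data-fitting term `f(z, D) = ½ ‖D z - y‖₂²`. -/
def dataFit {m n : ℕ} (y : Fin m → ℝ) (z : Fin n → ℝ) (D : Dict m n) : ℝ :=
  (1 / 2) * ∑ l, ((Matrix.of D *ᵥ z) l - y l) ^ 2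

/-- The Lasso objective `F(z, D) = ½ ‖D z - y‖₂² + lam ‖z‖₁`. -/
def lassoObj {m n : ℕ} (y : Fin m → ℝ) (lam : ℝ) (z : Fin n → ℝ) (D : Dict m n) : ℝ :=
  dataFit y z D + lam * ∑ i, |z i|

/-- `z` minimises `F(·, D)`. -/
def IsLassoSol {m n : ℕ} (y : Fin m → ℝ) (lam : ℝ) (D : Dict m n) (z : Fin n → ℝ) : Prop :=
  ∀ w : Fin n → ℝ, lassoObj y lam z D ≤ lassoObj y lam w D

/-- The open set of the dictionaries in a neighbourhood of which the Lasso solution is unique. -/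
def uniqueDomain {m : ℕ} (n : ℕ) (y : Fin m → ℝ) (lam : ℝ) : Set (Dict m n) :=
  interior {D | ∃! z, IsLassoSol y lam D z}

/-- The soft-thresholding `ST_μ(x) = sgn(x) (|x| - μ)₊`. -/
def softThreshold (μ x : ℝ) : ℝ := Real.sign x * max (|x| - μ) 0

/-- ISTA with step size `1 / L`: `z_0 = 0`,
`z_{N+1} = ST_{lam / L}(z_N - (1 / L) Dᵀ (D z_N - y))`. -/
def ista {m n : ℕ} (y : Fin m → ℝ) (lam L : ℝ) : ℕ → Dict m n → Fin n → ℝ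
  | 0, _ => 0
  | N + 1, D => fun i =>
      softThreshold (lam / L)
        ((ista y lam L N D
          - (1 / L) • ((Matrix.of D)ᵀ *ᵥ (Matrix.of D *ᵥ ista y lam L N D - y))) i)

/-- The spectral norm of `D` (operator norm between Euclidean spaces). -/
def specNorm {m n : ℕ} (D : Dict m n) : ℝ :=
  ‖LinearMap.toContinuousLinearMap (Matrix.toLpLin 2 2 (Matrix.of D))‖

/-- `J` is a weak Jacobian on the open set `U` of the map `u : ℝ^{m × n} → ℝ^n` relatively to the
`l`-th row: `J D i k` is the weak partial derivative of `u_i` with respect to `D_{lk}`, that is,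
`u_i` and `J i k` are locally integrable on `U` and `∫ u_i ∂φ/∂D_{lk} = - ∫ J_{ik} φ` for all
smooth test functions `φ` with compact support in `U`. -/
def IsWeakJacobianOn {m n : ℕ} (U : Set (Dict m n)) (u : Dict m n → Fin n → ℝ) (l : Fin m)
    (J : Dict m n → Matrix (Fin n) (Fin n) ℝ) : Prop :=
  (∀ i, LocallyIntegrableOn (fun D => u D i) U volume) ∧
  ∀ i k, LocallyIntegrableOn (fun D => J D i k) U volume ∧
    ∀ φ : Dict m n → ℝ, ContDiff ℝ ∞ φ → HasCompactSupport φ → tsupport φ ⊆ U →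
      ∫ D, u D i * fderiv ℝ φ D (Pi.single l (Pi.single k 1)) = - ∫ D, J D i k * φ D

/-- The matrix `D_l zᵀ + (D_lᵀ z - y_l) I_n`. -/
def rowTerm {m n : ℕ} (y : Fin m → ℝ) (D : Dict m n) (l : Fin m) (z : Fin n → ℝ) :
    Matrix (Fin n) (Fin n) ℝ :=
  Matrix.vecMulVec (D l) z + (D l ⬝ᵥ z - y l) • (1 : Matrix (Fin n) (Fin n) ℝ)

/-- One step of the recursion: with `z = z_N`, `z' = z_{N+1}`, and `J` the Jacobian of `z_N`,
`1_{|z'| > 0} ⊙ (J - (1 / L) (D_l zᵀ + (D_lᵀ z - y_l) I_n + Dᵀ D J))`. -/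
def jacStep {m n : ℕ} (y : Fin m → ℝ) (L : ℝ) (D : Dict m n) (l : Fin m) (z z' : Fin n → ℝ)
    (J : Matrix (Fin n) (Fin n) ℝ) : Matrix (Fin n) (Fin n) ℝ :=
  Matrix.of fun i k =>
    Set.indicator {j | 0 < |z' j|} (fun _ => (1 : ℝ)) i *
      (J - (1 / L) • (rowTerm y D l z + (Matrix.of D)ᵀ * Matrix.of D * J)) i k

/-- The Jacobians `J_l^N(D)` propagated along ISTA: `J_l^0 = 0` and the recursion. -/
def istaJac {m n : ℕ} (y : Fin m → ℝ) (lam L : ℝ) (l : Fin m) :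
    ℕ → Dict m n → Matrix (Fin n) (Fin n) ℝ
  | 0, _ => 0
  | N + 1, D => jacStep y L D l (ista y lam L N D) (ista y lam L (N + 1) D)
      (istaJac y lam L l N D)

/-- `D_{:,S}`, for `S` the support of `z`. -/
def supportCols {m n : ℕ} (D : Dict m n) (z : Fin n → ℝ) :
    Matrix (Fin m) {i : Fin n // z i ≠ 0} ℝ :=
  (Matrix.of D).submatrix id Subtype.val

open scoped Classical in
/-- `D_{:,S}ᵀ D_{:,S}`, for `S` the support of `z`. -/
def supportGram {m n : ℕ} (D : Dict m n) (z : Fin n → ℝ) :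
    Matrix {i : Fin n // z i ≠ 0} {i : Fin n // z i ≠ 0} ℝ :=
  (supportCols D z)ᵀ * supportCols D z

open scoped Classical in
/-- The matrix whose rows with index in the support `S` of `z` are those of
`-(D_{:,S}ᵀ D_{:,S})⁻¹ (D_l zᵀ + (D_lᵀ z - y_l) I_n)_S`, and whose other rows are zero. -/
def lassoJac {m n : ℕ} (y : Fin m → ℝ) (D : Dict m n) (l : Fin m) (z : Fin n → ℝ) :
    Matrix (Fin n) (Fin n) ℝ :=
  Matrix.of fun i k =>
    if h : z i ≠ 0 then
      -((supportGram D z)⁻¹ * (rowTerm y D l z).submatrix Subtype.val id :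
        Matrix {i : Fin n // z i ≠ 0} (Fin n) ℝ) ⟨i, h⟩ k
    else 0

/-- `∇²_{1,1} f(z, D)`, with entries `∂² f / ∂z_j ∂z_i`. -/
def hess11 {m n : ℕ} (y : Fin m → ℝ) (z : Fin n → ℝ) (D : Dict m n) :
    Matrix (Fin n) (Fin n) ℝ :=
  Matrix.of fun i j =>
    deriv (fun t : ℝ => deriv (fun s : ℝ =>
      dataFit y (z + t • Pi.single j 1 + s • Pi.single i 1) D) 0) 0

/-- `∇²_{2,1} f(z, D)`, with entries `∂² f / ∂z_j ∂D_{lk}`; the row index is the pair `(l, k)`. -/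
def hess21 {m n : ℕ} (y : Fin m → ℝ) (z : Fin n → ℝ) (D : Dict m n) :
    Matrix (Fin m × Fin n) (Fin n) ℝ :=
  Matrix.of fun p j =>
    deriv (fun t : ℝ => deriv (fun s : ℝ =>
      dataFit y (z + t • Pi.single j 1) (D + s • (Pi.single p.1 (Pi.single p.2 1) : Dict m n))) 0) 0

/-- The matrix of the full Jacobian `ℝ^{m × n} → ℝ^n` whose part relative to row `l` is `J l`. -/
def fullJac {m n : ℕ} (J : Fin m → Matrix (Fin n) (Fin n) ℝ) :
    Matrix (Fin n) (Fin m × Fin n) ℝ :=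
  Matrix.of fun i p => J p.1 i p.2

/-- `A ⊙ 1_S`: the columns with index outside `S` are set to zero. -/
def maskCols {ι : Type*} {n : ℕ} (A : Matrix ι (Fin n) ℝ) (S : Set (Fin n)) :
    Matrix ι (Fin n) ℝ :=
  Matrix.of fun p j => A p j * Set.indicator S (fun _ => (1 : ℝ)) j

/-- `R(J, S) = J⁺ (∇²_{1,1} f(z, D) ⊙ 1_S) + ∇²_{2,1} f(z, D) ⊙ 1_S`, an operator
`ℝ^n → ℝ^{m × n}` given by its matrix. -/
def residualOp {m n : ℕ} (y : Fin m → ℝ) (z : Fin n → ℝ) (D : Dict m n)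
    (J : Fin m → Matrix (Fin n) (Fin n) ℝ) (S : Set (Fin n)) :
    Matrix (Fin m × Fin n) (Fin n) ℝ :=
  (fullJac J)ᵀ * maskCols (hess11 y z D) S + maskCols (hess21 y z D) S

end

/-! The theorem rests on two facts. The iterates and, on Ω, the Lasso solution are locally Lipschitz
in `D`. For almost every `D` the solution is `Nondegenerate`: its support columns are independent,
and the correlations `corr` with the residual are strictly below `lam` in absolute value off the
support.

For a locally Lipschitz map, Rademacher's theorem and integration by parts turn the almost
everywhere derivative into a weak Jacobian (`isWeakJacobianOn_of_locallyLipschitzOn`), unique up to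
null sets (`IsWeakJacobianOn.ae_eq`). Parts 1 and 2 thus become pointwise computations.
Soft-thresholding is a difference of two positive parts, and a positive part has zero derivative
wherever it vanishes and is differentiable; this gives the indicator in the recursion. At a
nondegenerate dictionary the solution vanishes locally off the support, while on the support the
correlations are locally constant, equal to `lam` or `-lam`; differentiating them yields the linear
system that characterises `lassoJac` (`eq_lassoJac`).

Monotonicity of the optimality conditions bounds `‖D' (z - z')‖²` by a constant times `‖D - D'‖ ‖z -
z'‖`. This is a Lipschitz bound as soon as `D` is injective on the equicorrelation set, where the
correlation has absolute value `lam`. Such injectivity holds on all of Ω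
(`equiInjective_of_mem_uniqueDomain`): otherwise arbitrarily small rank-one changes of `D` produce a
solution whose support fills the equicorrelation set while a kernel vector survives there, so
uniqueness fails.

Nondegeneracy almost everywhere (`ae_nondegenerate`): the residual of a solution with independent
support `S` and given signs depends only on the columns in `S`, so equality `|corr| = lam` at
another column confines that column to one of two hyperplanes. There are finitely many supports and
signs.

For convergence, a telescoping descent inequality sends the objective gap to zero. At a
nondegenerate solution the iterates then converge and identify the support after finitely many
steps; from there on the Jacobian error is contracted on the support, up to a perturbation tending
to zero (`tendsto_istaJac`). The residual identity is the linear system for `lassoJac`, read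
entrywise. -/

instance isAddHaarMeasure_volume_dict (m n : ℕ) :
    (volume : Measure (Dict m n)).IsAddHaarMeasure :=
  Measure.pi.isAddHaarMeasure fun _ : Fin m => (volume : Measure (Fin n → ℝ))

/-! ### Weak derivatives of locally Lipschitz functions. -/

section WeakDerivative

variable {E : Type*} [NormedAddCommGroup E] [NormedSpace ℝ E]

lemma lineDeriv_congr_of_eqOn_isOpen {V : Set E} {f g : E → ℝ} (hV : IsOpen V)
    (hfg : Set.EqOn f g V) {x : E} (hx : x ∈ V) (v : E) :
    lineDeriv ℝ f x v = lineDeriv ℝ g x v :=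
  Filter.EventuallyEq.lineDeriv_eq (hfg.eventuallyEq_of_mem (hV.mem_nhds hx))

variable [FiniteDimensional ℝ E]

/-- A locally Lipschitz function on an open set agrees near a compact subset with a globally
Lipschitz function. -/
lemma LocallyLipschitzOn.exists_lipschitzWith_eqOn_nhds {U K : Set E} {f : E → ℝ}
    (hU : IsOpen U) (hK : IsCompact K) (hKU : K ⊆ U) (hf : LocallyLipschitzOn U f) :
    ∃ (C : NNReal) (g : E → ℝ) (V : Set E), LipschitzWith C g ∧ IsOpen V ∧ K ⊆ V ∧ V ⊆ U ∧
      Set.EqOn f g V := by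
  have := FiniteDimensional.proper_real E
  -- A closed thickening of `K` inside `U` is still compact, so one Lipschitz constant serves on it,
  -- and the restriction extends to the whole space.
  obtain ⟨δ, hδ, hKδ⟩ := hK.exists_cthickening_subset_open hU hKU
  obtain ⟨C, hC⟩ := LocallyLipschitzOn.exists_lipschitzOnWith_of_compact
    (hK.cthickening (r := δ)) (hf.mono hKδ)
  obtain ⟨g, hg, hfg⟩ := hC.extend_real
  exact ⟨C, g, Metric.thickening δ K, hg, Metric.isOpen_thickening,
    Metric.self_subset_thickening hδ K, (Metric.thickening_subset_cthickening δ K).trans hKδ,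
    hfg.mono (Metric.thickening_subset_cthickening δ K)⟩

variable [MeasurableSpace E] [BorelSpace E] {μ : Measure E} [μ.IsAddHaarMeasure]

/-- Rademacher's theorem for locally Lipschitz functions on open sets. -/
lemma LocallyLipschitzOn.ae_differentiableAt {U : Set E} {f : E → ℝ}
    (hU : IsOpen U) (hf : LocallyLipschitzOn U f) :
    ∀ᵐ x ∂μ, x ∈ U → DifferentiableAt ℝ f x := by
  suffices h : μ {x | x ∈ U ∧ ¬ DifferentiableAt ℝ f x} = 0 by
    rw [ae_iff]; simpa only [Classical.not_imp] using h
  refine measure_null_of_locally_null _ fun x hx => ?_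
  obtain ⟨C, g, V, hg, hV, hxV, -, hfg⟩ := hf.exists_lipschitzWith_eqOn_nhds hU
    (isCompact_singleton (x := x)) (by simpa using hx.1)
  refine ⟨_, inter_mem_nhdsWithin _ (hV.mem_nhds (by simpa using hxV)), ?_⟩
  refine measure_mono_null ?_ (ae_iff.1 (hg.ae_differentiableAt (μ := μ)))
  rintro w ⟨⟨-, hw⟩, hwV⟩ hd
  exact hw (hd.congr_of_eventuallyEq (hfg.eventuallyEq_of_mem (hV.mem_nhds hwV)))

/-- If `J` is almost everywhere the directional derivative of a locally Lipschitz function, then it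
is locally integrable. -/
lemma LocallyLipschitzOn.locallyIntegrableOn_of_ae_eq_lineDeriv {U : Set E} {f J : E → ℝ} {v : E}
    (hU : IsOpen U) (hf : LocallyLipschitzOn U f)
    (hJ : ∀ᵐ x ∂μ, x ∈ U → lineDeriv ℝ f x v = J x) :
    LocallyIntegrableOn J U μ := by
  intro x hx
  obtain ⟨C, g, V, hg, hV, hxV, hVU, hfg⟩ := hf.exists_lipschitzWith_eqOn_nhds hU
    (isCompact_singleton (x := x)) (by simpa using hx)
  obtain ⟨s, hs, hi⟩ := (hg.locallyIntegrable_lineDeriv (μ := μ) v) x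
  refine ⟨s ∩ V, mem_nhdsWithin_of_mem_nhds (inter_mem hs (hV.mem_nhds (by simpa using hxV))), ?_⟩
  refine (hi.mono_set Set.inter_subset_left).congr ?_
  have : ∀ᵐ x ∂(μ.restrict V), lineDeriv ℝ g x v = J x := by
    rw [ae_restrict_iff' hV.measurableSet]
    filter_upwards [hJ] with w hw hwV
    rw [← hw (hVU hwV), lineDeriv_congr_of_eqOn_isOpen hV hfg hwV]
  exact ae_restrict_of_ae_restrict_of_subset Set.inter_subset_right this

/-- Integration by parts for locally Lipschitz functions. -/
lemma LocallyLipschitzOn.integral_mul_fderiv_eq {U : Set E} {f J φ : E → ℝ} {v : E}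
    (hU : IsOpen U) (hf : LocallyLipschitzOn U f)
    (hJ : ∀ᵐ x ∂μ, x ∈ U → lineDeriv ℝ f x v = J x)
    (hφ : ContDiff ℝ ∞ φ) (hφc : HasCompactSupport φ) (hφU : tsupport φ ⊆ U) :
    ∫ x, f x * fderiv ℝ φ x v ∂μ = - ∫ x, J x * φ x ∂μ := by
  obtain ⟨C, g, V, hg, hV, hKV, hVU, hfg⟩ :=
    hf.exists_lipschitzWith_eqOn_nhds hU hφc hφU
  obtain ⟨D, hD⟩ := hφ.lipschitzWith_of_hasCompactSupport hφc (by simp)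
  have key := hg.integral_lineDeriv_mul_eq (μ := μ) hD hφc v
  have h1 : ∫ x, lineDeriv ℝ g x v * φ x ∂μ = ∫ x, J x * φ x ∂μ := by
    refine integral_congr_ae ?_
    filter_upwards [hJ] with x hx
    by_cases hxs : x ∈ tsupport φ
    · rw [← hx (hφU hxs), lineDeriv_congr_of_eqOn_isOpen hV hfg (hKV hxs)]
    · simp [image_eq_zero_of_notMem_tsupport hxs]
  -- The integration by parts formula differentiates `φ` along `-v`, which supplies the minus sign.
  -- Off the support of `φ`, where `f` and `g` may differ, the derivative of `φ` vanishes.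
  have h2 : ∫ x, lineDeriv ℝ φ x (-v) * g x ∂μ = - ∫ x, f x * fderiv ℝ φ x v ∂μ := by
    rw [← integral_neg]
    refine integral_congr_ae (Eventually.of_forall fun x => ?_)
    have hd : DifferentiableAt ℝ φ x := (hφ.differentiable (by simp)) x
    simp only [hd.lineDeriv_eq_fderiv, map_neg]
    by_cases hxs : x ∈ tsupport φ
    · rw [hfg (hKV hxs)]; ring
    · have : fderiv ℝ φ x = 0 :=
        image_eq_zero_of_notMem_tsupport fun h => hxs (tsupport_fderiv_subset ℝ h)
      simp [this]
  rw [h1, h2] at key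
  linarith

end WeakDerivative

/-- A locally Lipschitz map has its almost everywhere derivative as weak Jacobian. -/
lemma isWeakJacobianOn_of_locallyLipschitzOn {m n : ℕ} {U : Set (Dict m n)}
    {u : Dict m n → Fin n → ℝ} {l : Fin m} {J : Dict m n → Matrix (Fin n) (Fin n) ℝ}
    (hU : IsOpen U) (hu : ∀ i, LocallyLipschitzOn U fun D => u D i)
    (hJ : ∀ᵐ D : Dict m n, D ∈ U → ∀ i k,
      lineDeriv ℝ (fun D => u D i) D (Pi.single l (Pi.single k 1)) = J D i k) :
    IsWeakJacobianOn U u l J := by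
  refine ⟨fun i => (hu i).continuousOn.locallyIntegrableOn hU.measurableSet, fun i k => ?_⟩
  have h : ∀ᵐ D : Dict m n, D ∈ U →
      lineDeriv ℝ (fun D => u D i) D (Pi.single l (Pi.single k 1)) = J D i k := by
    filter_upwards [hJ] with D hD hDU using hD hDU i k
  exact ⟨(hu i).locallyIntegrableOn_of_ae_eq_lineDeriv hU h,
    fun φ hφ hφc hφU => (hu i).integral_mul_fderiv_eq hU h hφ hφc hφU⟩

/-- Weak Jacobians are unique up to null sets. -/
lemma IsWeakJacobianOn.ae_eq {m n : ℕ} {U : Set (Dict m n)}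
    {u : Dict m n → Fin n → ℝ} {l : Fin m} {J J' : Dict m n → Matrix (Fin n) (Fin n) ℝ}
    (hU : IsOpen U) (h : IsWeakJacobianOn U u l J) (h' : IsWeakJacobianOn U u l J') :
    ∀ᵐ D : Dict m n, D ∈ U → J D = J' D := by
  have key : ∀ i k, ∀ᵐ D : Dict m n, D ∈ U → J D i k - J' D i k = 0 := by
    intro i k
    obtain ⟨hi, hJ⟩ := h.2 i k
    obtain ⟨hi', hJ'⟩ := h'.2 i k
    refine hU.ae_eq_zero_of_integral_contDiff_smul_eq_zero (hi.sub hi') fun φ hφ hφc hφU => ?_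
    have hint : ∀ {g : Dict m n → ℝ}, LocallyIntegrableOn g U volume →
        Integrable (fun D => φ D * g D) volume := by
      intro g hg
      have hK := hg.integrableOn_compact_subset hφU hφc
      have := (integrableOn_iff_integrable_of_support_subset
        (f := fun D => φ D * g D) (s := tsupport φ) ?_).1
          (hK.continuousOn_mul hφ.continuous.continuousOn hφc)
      · exact this
      · exact (Function.support_mul_subset_left _ _).trans (subset_tsupport φ)
    have e := (hJ φ hφ hφc hφU).symm.trans (hJ' φ hφ hφc hφU)
    have h1 : ∫ D, φ D • (J D i k - J' D i k)
        = (∫ D, φ D * J D i k) - ∫ D, φ D * J' D i k := by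
      rw [← integral_sub (hint hi) (hint hi')]
      simp only [smul_eq_mul, mul_sub]
    have h2 : ∀ g : Dict m n → ℝ, ∫ D, φ D * g D = ∫ D, g D * φ D := fun g => by
      simp only [mul_comm]
    show ∫ D, φ D • (J D i k - J' D i k) = 0
    rw [h1, h2 fun D => J D i k, h2 fun D => J' D i k]
    linarith
  filter_upwards [ae_all_iff.2 fun i => ae_all_iff.2 (key i)] with D hD hDU
  ext i k
  linarith [hD i k hDU]

/-! ### Soft-thresholding and its chain rule. -/

section SoftThreshold

lemma softThreshold_eq_sub {μ : ℝ} (hμ : 0 ≤ μ) (x : ℝ) :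
    softThreshold μ x = max (x - μ) 0 - max (-x - μ) 0 := by
  unfold softThreshold
  rcases lt_trichotomy x 0 with hx | rfl | hx
  · rw [Real.sign_of_neg hx, abs_of_neg hx, max_eq_right (a := x - μ) (by linarith)]; ring
  · simp [hμ]
  · rw [Real.sign_of_pos hx, abs_of_pos hx, max_eq_right (a := -x - μ) (by linarith)]; ring

lemma locallyLipschitz_softThreshold {μ : ℝ} (hμ : 0 ≤ μ) : LocallyLipschitz (softThreshold μ) := by
  have h : softThreshold μ = fun x => max (x - μ) 0 - max (-x - μ) 0 :=
    funext (softThreshold_eq_sub hμ)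
  rw [h]
  have h1 : LipschitzWith 1 fun x : ℝ => x - μ := by
    simpa [sub_eq_add_neg] using (LipschitzWith.id (α := ℝ)).add (LipschitzWith.const (-μ))
  have h2 : LipschitzWith 1 fun x : ℝ => -x - μ := by
    simpa [sub_eq_add_neg] using (LipschitzWith.id (α := ℝ)).neg.add (LipschitzWith.const (-μ))
  exact ((h1.max_const 0).sub (h2.max_const 0)).locallyLipschitz

lemma softThreshold_of_abs_le {μ x : ℝ} (hx : |x| ≤ μ) : softThreshold μ x = 0 := by
  simp [softThreshold, hx]

lemma softThreshold_ne_zero {μ x : ℝ} (hμ : 0 ≤ μ) (hx : μ < |x|) : softThreshold μ x ≠ 0 := by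
  have h0 : x ≠ 0 := by rintro rfl; simp at hx; linarith
  have h1 : max (|x| - μ) 0 = |x| - μ := max_eq_left (by linarith)
  rw [softThreshold, h1]
  refine mul_ne_zero ?_ (by linarith)
  simpa [Real.sign_eq_zero_iff] using h0

variable {E : Type*} [NormedAddCommGroup E] [NormedSpace ℝ E]

/-- A nonnegative function has vanishing derivative where it vanishes. -/
lemma fderiv_max_zero_of_le {u : E → ℝ} {x : E} (hx : u x ≤ 0) :
    fderiv ℝ (fun w => max (u w) 0) x = 0 := by
  refine IsLocalMin.fderiv_eq_zero (Eventually.of_forall fun w => ?_)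
  simp [hx]

lemma fderiv_max_zero_of_lt {u : E → ℝ} {x : E} (hu : ContinuousAt u x) (hx : 0 < u x) :
    fderiv ℝ (fun w => max (u w) 0) x = fderiv ℝ u x := by
  refine Filter.EventuallyEq.fderiv_eq ?_
  filter_upwards [hu.eventually (lt_mem_nhds hx)] with w hw using max_eq_left hw.le

/-- Differentiability of the two positive parts is assumed separately. A positive part that vanishes
at `x` has a minimum there, so its derivative is zero even on the boundary `|u x| = μ`; no statement
about the measure of that level set is needed. -/
lemma fderiv_softThreshold_comp {μ : ℝ} (hμ : 0 < μ) {u : E → ℝ} {x : E}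
    (hu : DifferentiableAt ℝ u x)
    (h1 : DifferentiableAt ℝ (fun w => max (u w - μ) 0) x)
    (h2 : DifferentiableAt ℝ (fun w => max (-u w - μ) 0) x) :
    fderiv ℝ (fun w => softThreshold μ (u w)) x
      = if softThreshold μ (u x) ≠ 0 then fderiv ℝ u x else 0 := by
  have e : (fun w => softThreshold μ (u w))
      = fun w => max (u w - μ) 0 - max (-u w - μ) 0 := by
    funext w; exact softThreshold_eq_sub hμ.le _
  rw [e, fderiv_fun_sub h1 h2]
  rcases le_or_gt |u x| μ with hx | hx
  · obtain ⟨ha, hb⟩ := abs_le.1 hx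
    rw [fderiv_max_zero_of_le (by linarith), fderiv_max_zero_of_le (by linarith),
      softThreshold_of_abs_le hx]
    simp
  · rw [if_pos (softThreshold_ne_zero hμ.le hx)]
    rcases lt_abs.1 hx with h | h
    · rw [fderiv_max_zero_of_lt (u := fun w => u w - μ) (hu.continuousAt.sub continuousAt_const)
        (by linarith), fderiv_max_zero_of_le (by linarith), fderiv_sub_const]
      simp
    · rw [fderiv_max_zero_of_le (by linarith),
        fderiv_max_zero_of_lt (u := fun w => -u w - μ)
          (hu.continuousAt.neg.sub continuousAt_const) (by linarith),
        fderiv_sub_const, fderiv_fun_neg]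
      simp

end SoftThreshold

/-! ### ISTA iterates and the recursion for their Jacobians. -/

section Ista

variable {m n : ℕ}

/-- The correlations `Dᵀ (y - D z)` of the dictionary columns with the residual. -/
def corr (y : Fin m → ℝ) (D : Dict m n) (z : Fin n → ℝ) : Fin n → ℝ :=
  (Matrix.of D)ᵀ *ᵥ (y - Matrix.of D *ᵥ z)

lemma corr_apply (y : Fin m → ℝ) (D : Dict m n) (z : Fin n → ℝ) (i : Fin n) :
    corr y D z i = ∑ l, D l i * (y l - ∑ k, D l k * z k) := by
  simp [corr, Matrix.mulVec, dotProduct]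

lemma contDiff_corr (y : Fin m → ℝ) :
    ContDiff ℝ ∞ fun p : Dict m n × (Fin n → ℝ) => corr y p.1 p.2 := by
  rw [contDiff_pi]
  intro i
  simp only [corr_apply]
  fun_prop

lemma ista_succ_apply (y : Fin m → ℝ) (lam L : ℝ) (N : ℕ) (D : Dict m n) (i : Fin n) :
    ista y lam L (N + 1) D i
      = softThreshold (lam / L) (ista y lam L N D i + (1 / L) * corr y D (ista y lam L N D) i) := by
  have h : (Matrix.of D)ᵀ *ᵥ (Matrix.of D *ᵥ ista y lam L N D - y)
      = - corr y D (ista y lam L N D) := by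
    rw [corr, ← Matrix.mulVec_neg, neg_sub]
  rw [ista, h]
  simp

/-- The gradient step, before thresholding, is locally Lipschitz in the dictionary. -/
lemma locallyLipschitz_gradStep (y : Fin m → ℝ) (L : ℝ) {u : Dict m n → Fin n → ℝ}
    (hu : LocallyLipschitz u) (i : Fin n) :
    LocallyLipschitz fun D => u D i + (1 / L) * corr y D (u D) i := by
  have h : ContDiff ℝ 1 fun p : Dict m n × (Fin n → ℝ) => p.2 i + (1 / L) * corr y p.1 p.2 i := by
    have := (contDiff_pi.1 (contDiff_corr (n := n) y) i).of_le (m := 1) (by simp)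
    fun_prop
  exact h.locallyLipschitz.comp (LocallyLipschitz.id.prodMk hu)

lemma locallyLipschitz_pi {E : Type*} [NormedAddCommGroup E] [NormedSpace ℝ E]
    {u : E → Fin n → ℝ} (h : ∀ i, LocallyLipschitz fun x => u x i) : LocallyLipschitz u := by
  intro x
  choose K t ht hK using fun i => h i x
  refine ⟨Finset.univ.sup K, ⋂ i, t i, iInter_mem.2 ht, fun a ha b hb => ?_⟩
  rw [edist_pi_le_iff]
  intro i
  refine (hK i (Set.mem_iInter.1 ha i) (Set.mem_iInter.1 hb i)).trans ?_
  gcongr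
  exact Finset.le_sup (Finset.mem_univ i)

lemma locallyLipschitz_ista (y : Fin m → ℝ) {lam L : ℝ} (hlam : 0 < lam) (hL : 0 < L) (N : ℕ) :
    LocallyLipschitz (ista (n := n) y lam L N) := by
  induction N with
  | zero => exact LocallyLipschitz.const 0
  | succ N ih =>
    refine locallyLipschitz_pi fun i => ?_
    simp only [ista_succ_apply]
    exact (locallyLipschitz_softThreshold (by positivity)).comp (locallyLipschitz_gradStep y L ih i)

lemma LocallyLipschitz.ae_differentiableAt {E : Type*} [NormedAddCommGroup E] [NormedSpace ℝ E]
    [FiniteDimensional ℝ E] [MeasurableSpace E] [BorelSpace E] {μ : Measure E}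
    [μ.IsAddHaarMeasure] {f : E → ℝ} (hf : LocallyLipschitz f) :
    ∀ᵐ x ∂μ, DifferentiableAt ℝ f x := by
  simpa using (hf.locallyLipschitzOn (s := Set.univ)).ae_differentiableAt (μ := μ) isOpen_univ

lemma rowTerm_apply (y : Fin m → ℝ) (D : Dict m n) (l : Fin m) (z : Fin n → ℝ) (i k : Fin n) :
    rowTerm y D l z i k = D l i * z k + if i = k then (∑ j, D l j * z j) - y l else 0 := by
  simp [rowTerm, Matrix.vecMulVec_apply, Matrix.one_apply, dotProduct]

lemma gram_mul_apply (D : Dict m n) (J : Matrix (Fin n) (Fin n) ℝ) (i k : Fin n) :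
    ((Matrix.of D)ᵀ * Matrix.of D * J) i k = ∑ l, D l i * ∑ j, D l j * J j k := by
  rw [Matrix.mul_assoc]
  simp [Matrix.mul_apply]

/-- The derivative of `Dᵀ (y - D u(D))` in direction `D_{lk}`. -/
lemma hasFDerivAt_corr_comp (y : Fin m → ℝ) {u : Dict m n → Fin n → ℝ} {D : Dict m n}
    {l : Fin m} {J : Matrix (Fin n) (Fin n) ℝ} (k : Fin n)
    (hu : ∀ i, DifferentiableAt ℝ (fun D => u D i) D)
    (hJ : ∀ i, fderiv ℝ (fun D => u D i) D (Pi.single l (Pi.single k 1)) = J i k) (i : Fin n) :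
    DifferentiableAt ℝ (fun D => corr y D (u D) i) D ∧
    fderiv ℝ (fun D => corr y D (u D) i) D (Pi.single l (Pi.single k 1))
      = - (rowTerm y D l (u D) + (Matrix.of D)ᵀ * Matrix.of D * J) i k := by
  have hD : ∀ a b, HasFDerivAt (fun D : Dict m n => D a b)
      ((ContinuousLinearMap.proj (R := ℝ) (φ := fun _ : Fin n => ℝ) b).comp
        (ContinuousLinearMap.proj (R := ℝ) (φ := fun _ : Fin m => Fin n → ℝ) a)) D := fun a b =>
    ((ContinuousLinearMap.proj (R := ℝ) (φ := fun _ : Fin n => ℝ) b).comp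
        (ContinuousLinearMap.proj (R := ℝ) (φ := fun _ : Fin m => Fin n → ℝ) a)).hasFDerivAt
  have key := HasFDerivAt.fun_sum (u := Finset.univ) fun a _ => (hD a i).mul
    ((hasFDerivAt_const (y a) D).sub
      (HasFDerivAt.fun_sum (u := Finset.univ) fun j _ => (hD a j).mul (hu j).hasFDerivAt))
  have e : (fun D => corr y D (u D) i)
      = fun D : Dict m n => ∑ a, D a i * (y a - ∑ j, D a j * u D j) := by
    funext D; exact corr_apply y D (u D) i
  rw [e]
  refine ⟨key.differentiableAt, ?_⟩
  have hs : ∀ a b, (Pi.single l (Pi.single k (1 : ℝ)) : Dict m n) a b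
      = if a = l then (if b = k then 1 else 0) else 0 := by
    intro a b
    rcases eq_or_ne a l with rfl | h
    · simp [Pi.single_apply]
    · simp [h]
  refine (congrArg (fun T => T (Pi.single l (Pi.single k 1))) key.fderiv).trans ?_
  simp only [sum_apply, add_apply,
    smul_apply, sub_apply, zero_apply,
    ContinuousLinearMap.comp_apply, ContinuousLinearMap.proj_apply, hs, hJ, smul_eq_mul,
    Matrix.add_apply, rowTerm_apply, gram_mul_apply]
  simp only [Pi.mul_apply, Pi.sub_apply, mul_ite, mul_one, mul_zero, Finset.sum_add_distrib,
    Finset.sum_ite_eq', Finset.mem_univ, if_true, zero_sub, mul_neg, mul_add, neg_add]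
  have h : ∑ a, -(D a i * ∑ b, if a = l then if b = k then u D b else 0 else 0)
      = -(D l i * u D k) := by
    rw [Finset.sum_eq_single l (fun b _ hb => by simp [hb]) (by simp)]
    simp
  rw [h, Finset.sum_neg_distrib]
  split_ifs <;> ring

/-- The propagated matrices are almost everywhere the derivatives of the ISTA iterates. -/
lemma ae_fderiv_ista (y : Fin m → ℝ) {lam L : ℝ} (hlam : 0 < lam) (hL : 0 < L) (l : Fin m)
    (N : ℕ) : ∀ᵐ D : Dict m n, ∀ i, DifferentiableAt ℝ (fun D => ista y lam L N D i) D ∧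
      ∀ k, fderiv ℝ (fun D => ista y lam L N D i) D (Pi.single l (Pi.single k 1))
        = istaJac y lam L l N D i k := by
  induction N with
  | zero =>
    refine Eventually.of_forall fun D i => ?_
    have e : (fun D : Dict m n => ista y lam L 0 D i) = fun _ => 0 := rfl
    rw [e]
    exact ⟨differentiableAt_const _, fun k => by simp [istaJac]⟩
  | succ N ih =>
    have hμ : 0 < lam / L := by positivity
    have hz := locallyLipschitz_ista (n := n) y hlam hL N
    have hmax : LocallyLipschitz fun x : ℝ => max (x - lam / L) 0 := by
      have h : LipschitzWith 1 fun x : ℝ => x - lam / L := by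
        simpa [sub_eq_add_neg] using
          (LipschitzWith.id (α := ℝ)).add (LipschitzWith.const (-(lam / L)))
      exact (h.max_const 0).locallyLipschitz
    have hneg : LocallyLipschitz fun x : ℝ => -x := (LipschitzWith.id (α := ℝ)).neg.locallyLipschitz
    -- Rademacher's theorem is applied to each positive part as well as to their difference, as
    -- `fderiv_softThreshold_comp` requires.
    have h1 := ae_all_iff.2 fun i => (hmax.comp
      (locallyLipschitz_gradStep y L hz i)).ae_differentiableAt (μ := (volume : Measure (Dict m n)))
    have h2 := ae_all_iff.2 fun i => (hmax.comp (hneg.comp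
      (locallyLipschitz_gradStep y L hz i))).ae_differentiableAt
        (μ := (volume : Measure (Dict m n)))
    have h3 := ae_all_iff.2 fun i => ((locallyLipschitz_softThreshold hμ.le).comp
      (locallyLipschitz_gradStep y L hz i)).ae_differentiableAt (μ := (volume : Measure (Dict m n)))
    filter_upwards [ih, h1, h2, h3] with D hD h1 h2 h3 i
    simp only [ista_succ_apply]
    refine ⟨h3 i, fun k => ?_⟩
    obtain ⟨hc, hc'⟩ := hasFDerivAt_corr_comp y (J := istaJac y lam L l N D) k
      (fun i => (hD i).1) (fun i => (hD i).2 k) i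
    have hg : DifferentiableAt ℝ (fun D => ista y lam L N D i
        + (1 / L) * corr y D (ista y lam L N D) i) D := (hD i).1.add (hc.const_mul _)
    rw [fderiv_softThreshold_comp hμ hg (h1 i) (h2 i), ← ista_succ_apply, istaJac, jacStep]
    simp only [Matrix.of_apply, Set.indicator_apply, Set.mem_ofPred_eq, abs_pos]
    split_ifs with h
    · rw [fderiv_fun_add (hD i).1 (hc.const_mul _), fderiv_const_mul hc, add_apply, smul_apply, hc',
        (hD i).2 k]
      simp only [smul_eq_mul, Matrix.sub_apply, Matrix.smul_apply, Matrix.add_apply]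
      ring
    · simp

theorem isWeakJacobianOn_ista (y : Fin m → ℝ) {lam L : ℝ} (hlam : 0 < lam) (hL : 0 < L) (N : ℕ)
    (l : Fin m) :
    IsWeakJacobianOn (n := n) Set.univ (ista y lam L N) l (istaJac y lam L l N) := by
  refine isWeakJacobianOn_of_locallyLipschitzOn isOpen_univ (fun i => ?_) ?_
  · have h : LipschitzWith 1 fun z : Fin n → ℝ => z i := LipschitzWith.eval i
    exact (h.locallyLipschitz.comp (locallyLipschitz_ista y hlam hL N)).locallyLipschitzOn
  · filter_upwards [ae_fderiv_ista (n := n) y hlam hL l N] with D hD _ i k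
    rw [(hD i).1.lineDeriv_eq_fderiv, (hD i).2 k]

lemma ae_eq_istaJac {y : Fin m → ℝ} {lam L : ℝ} (hlam : 0 < lam) (hL : 0 < L) {N : ℕ}
    {l : Fin m} {J : Dict m n → Matrix (Fin n) (Fin n) ℝ}
    (hJ : IsWeakJacobianOn Set.univ (ista y lam L N) l J) :
    ∀ᵐ D : Dict m n, J D = istaJac y lam L l N D := by
  simpa using hJ.ae_eq isOpen_univ (isWeakJacobianOn_ista y hlam hL N l)

end Ista

/-! ### Optimality conditions and the structure of the solution set. -/

section Optimality

variable {m n : ℕ} {y : Fin m → ℝ} {lam : ℝ} {D : Dict m n} {z : Fin n → ℝ}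

lemma transpose_mulVec_dotProduct (D : Dict m n) (r : Fin m → ℝ) (x : Fin n → ℝ) :
    ((Matrix.of D)ᵀ *ᵥ r) ⬝ᵥ x = r ⬝ᵥ (Matrix.of D *ᵥ x) := by
  rw [Matrix.mulVec_transpose, Matrix.dotProduct_mulVec]

/-- The data-fitting term is quadratic, so its expansion around `z` is exact, with gradient `-corr y
D z`. The optimality conditions, the gap formula and the descent inequality all start from this
identity. -/
lemma lassoObj_sub_lassoObj (y : Fin m → ℝ) (lam : ℝ) (D : Dict m n) (z w : Fin n → ℝ) :
    lassoObj y lam w D - lassoObj y lam z D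
      = (1 / 2) * ∑ l, ((Matrix.of D *ᵥ (w - z)) l) ^ 2
        + ∑ j, (lam * |w j| - corr y D z j * w j) - ∑ j, (lam * |z j| - corr y D z j * z j) := by
  have h := transpose_mulVec_dotProduct D (y - Matrix.of D *ᵥ z) (w - z)
  have e : ∑ l, ((Matrix.of D *ᵥ w) l - y l) ^ 2
      = ∑ l, ((Matrix.of D *ᵥ z) l - y l) ^ 2 + ∑ l, ((Matrix.of D *ᵥ (w - z)) l) ^ 2
        - 2 * ((y - Matrix.of D *ᵥ z) ⬝ᵥ (Matrix.of D *ᵥ (w - z))) := by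
    simp only [dotProduct, Finset.mul_sum, ← Finset.sum_add_distrib, ← Finset.sum_sub_distrib,
      Matrix.mulVec_sub, Pi.sub_apply]
    refine Finset.sum_congr rfl fun l _ => ?_
    ring
  have h' : corr y D z ⬝ᵥ (w - z) = ∑ j, corr y D z j * w j - ∑ j, corr y D z j * z j := by
    simp only [dotProduct, Pi.sub_apply, mul_sub, Finset.sum_sub_distrib]
  simp only [lassoObj, dataFit, Finset.sum_sub_distrib, ← Finset.mul_sum]
  rw [e, ← h]
  rw [show ((Matrix.of D)ᵀ *ᵥ (y - Matrix.of D *ᵥ z)) = corr y D z from rfl, h']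
  ring

lemma mulVec_single_smul (D : Dict m n) (j : Fin n) (t : ℝ) (l : Fin m) :
    (Matrix.of D *ᵥ (Pi.single j t)) l = t * D l j := by
  simp [mul_comm]

/-- Divide by `|t|` and let `t` tend to zero from either side; the quadratic term disappears. -/
lemma abs_le_of_forall_mul_le {g a C : ℝ} (h : ∀ t : ℝ, g * t ≤ a * |t| + C * t ^ 2) :
    |g| ≤ a := by
  have key : ∀ s : ℝ, |s| = 1 → g * s ≤ a := by
    intro s hs
    have hlim : Tendsto (fun t : ℝ => a + C * t) (𝓝[>] 0) (𝓝 (a + C * 0)) :=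
      tendsto_nhdsWithin_of_tendsto_nhds
        (by fun_prop : Continuous fun t : ℝ => a + C * t).continuousAt
    rw [mul_zero, add_zero] at hlim
    refine ge_of_tendsto hlim ?_
    filter_upwards [self_mem_nhdsWithin] with t ht
    have ht' : (0 : ℝ) < t := ht
    have := h (t * s)
    rw [abs_mul, hs, abs_of_pos ht', mul_pow, ← sq_abs s, hs] at this
    refine le_of_mul_le_mul_right ?_ ht'
    nlinarith
  refine abs_le.2 ⟨?_, ?_⟩
  · have := key (-1) (by simp); linarith
  · have := key 1 (by simp); linarith

lemma mul_abs_sub_mul_nonneg {g a : ℝ} (h : |g| ≤ a) (x : ℝ) : 0 ≤ a * |x| - g * x := by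
  have h3 : g * x ≤ |g| * |x| := by rw [← abs_mul]; exact le_abs_self _
  have h4 := mul_le_mul_of_nonneg_right h (abs_nonneg x)
  linarith

/-- The optimality conditions of the Lasso. -/
theorem isLassoSol_iff (hlam : 0 ≤ lam) : IsLassoSol y lam D z ↔
    ∀ j, |corr y D z j| ≤ lam ∧ corr y D z j * z j = lam * |z j| := by
  constructor
  · intro h j
    have step : ∀ t : ℝ, 0 ≤ t ^ 2 * ((1 / 2) * ∑ l, D l j ^ 2)
        + (lam * |z j + t| - lam * |z j|) - corr y D z j * t := by
      intro t
      have h1 := h (z + Pi.single j t)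
      have h2 := lassoObj_sub_lassoObj y lam D z (z + Pi.single j t)
      have e1 : ∑ l, ((Matrix.of D *ᵥ (z + Pi.single j t - z)) l) ^ 2
          = t ^ 2 * ∑ l, D l j ^ 2 := by
        rw [add_sub_cancel_left, Finset.mul_sum]
        refine Finset.sum_congr rfl fun l _ => ?_
        rw [mulVec_single_smul, mul_pow]
      have e2 : ∑ i, (lam * |(z + Pi.single j t : Fin n → ℝ) i|
            - corr y D z i * (z + Pi.single j t : Fin n → ℝ) i)
          - ∑ i, (lam * |z i| - corr y D z i * z i)
          = (lam * |z j + t| - lam * |z j|) - corr y D z j * t := by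
        rw [← Finset.sum_sub_distrib, Finset.sum_eq_single j]
        · simp; ring
        · intro b _ hb; simp [hb]
        · simp
      rw [e1] at h2
      linarith
    have hle : |corr y D z j| ≤ lam := by
      refine abs_le_of_forall_mul_le (C := (1 / 2) * ∑ l, D l j ^ 2) fun t => ?_
      have h1 := step t
      have h2 : lam * |z j + t| ≤ lam * (|z j| + |t|) :=
        mul_le_mul_of_nonneg_left (abs_add_le _ _) hlam
      linarith
    refine ⟨hle, le_antisymm ?_ ?_⟩
    · calc corr y D z j * z j ≤ |corr y D z j| * |z j| := by rw [← abs_mul]; exact le_abs_self _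
        _ ≤ _ := mul_le_mul_of_nonneg_right hle (abs_nonneg _)
    -- Shrinking the coordinate, `t = -(s * z j)` with small `s > 0`, decreases the penalty at first
    -- order by exactly `s * lam * |z j|`; dividing by `s` gives the reverse inequality.
    · have hlim : Tendsto (fun s : ℝ => s * (z j ^ 2 * ((1 / 2) * ∑ l, D l j ^ 2))) (𝓝[>] 0)
          (𝓝 (0 * (z j ^ 2 * ((1 / 2) * ∑ l, D l j ^ 2)))) :=
        tendsto_nhdsWithin_of_tendsto_nhds (by fun_prop : Continuous fun s : ℝ =>
          s * (z j ^ 2 * ((1 / 2) * ∑ l, D l j ^ 2))).continuousAt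
      rw [zero_mul] at hlim
      have h0 : lam * |z j| - corr y D z j * z j ≤ 0 := by
        refine ge_of_tendsto hlim ?_
        filter_upwards [Ioo_mem_nhdsGT (zero_lt_one (α := ℝ))] with s hs
        have h1 := step (-(s * z j))
        have h2 : |z j + -(s * z j)| = (1 - s) * |z j| := by
          rw [show z j + -(s * z j) = (1 - s) * z j by ring, abs_mul,
            abs_of_pos (by linarith [hs.2])]
        rw [h2] at h1
        refine le_of_mul_le_mul_right ?_ hs.1
        linarith
      linarith
  · intro h w
    have h2 := lassoObj_sub_lassoObj y lam D z w
    have e0 : ∑ j, (lam * |z j| - corr y D z j * z j) = 0 :=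
      Finset.sum_eq_zero fun j _ => by rw [(h j).2, sub_self]
    have e1 : 0 ≤ ∑ j, (lam * |w j| - corr y D z j * w j) :=
      Finset.sum_nonneg fun j _ => mul_abs_sub_mul_nonneg (h j).1 (w j)
    have e2 : 0 ≤ ∑ l, ((Matrix.of D *ᵥ (w - z)) l) ^ 2 := Finset.sum_nonneg fun _ _ => sq_nonneg _
    linarith

lemma IsLassoSol.abs_corr_le (hlam : 0 ≤ lam) (h : IsLassoSol y lam D z) (j : Fin n) :
    |corr y D z j| ≤ lam := ((isLassoSol_iff hlam).1 h j).1

lemma IsLassoSol.corr_mul (hlam : 0 ≤ lam) (h : IsLassoSol y lam D z) (j : Fin n) :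
    corr y D z j * z j = lam * |z j| := ((isLassoSol_iff hlam).1 h j).2

lemma IsLassoSol.abs_corr_eq (hlam : 0 ≤ lam) (h : IsLassoSol y lam D z) {j : Fin n}
    (hj : z j ≠ 0) : |corr y D z j| = lam := by
  have h1 := congrArg abs (h.corr_mul hlam j)
  rw [abs_mul, abs_mul, abs_abs, abs_of_nonneg hlam] at h1
  exact mul_right_cancel₀ (abs_ne_zero.2 hj) h1

lemma IsLassoSol.eq_zero_of_abs_corr_lt (hlam : 0 ≤ lam) (h : IsLassoSol y lam D z) {j : Fin n}
    (hj : |corr y D z j| < lam) : z j = 0 := by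
  by_contra h0
  exact hj.ne (h.abs_corr_eq hlam h0)

/-- The suboptimality gap of the Lasso objective. -/
lemma IsLassoSol.gap (hlam : 0 ≤ lam) (h : IsLassoSol y lam D z) (w : Fin n → ℝ) :
    lassoObj y lam w D - lassoObj y lam z D
      = (1 / 2) * ∑ l, ((Matrix.of D *ᵥ (w - z)) l) ^ 2
        + ∑ j, (lam * |w j| - corr y D z j * w j) := by
  have e0 : ∑ j, (lam * |z j| - corr y D z j * z j) = 0 :=
    Finset.sum_eq_zero fun j _ => by rw [h.corr_mul hlam, sub_self]
  rw [lassoObj_sub_lassoObj, e0, sub_zero]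

/-- In the gap formula both terms are nonnegative and the gap is at most zero, so the quadratic term
vanishes. Hence fit and correlations are the same for all solutions. -/
lemma IsLassoSol.mulVec_eq (hlam : 0 ≤ lam) (h : IsLassoSol y lam D z) {w : Fin n → ℝ}
    (hw : IsLassoSol y lam D w) : Matrix.of D *ᵥ w = Matrix.of D *ᵥ z := by
  have h1 := h.gap hlam w
  have h2 : 0 ≤ ∑ j, (lam * |w j| - corr y D z j * w j) :=
    Finset.sum_nonneg fun j _ => mul_abs_sub_mul_nonneg (h.abs_corr_le hlam j) (w j)
  have h3 : ∑ l, ((Matrix.of D *ᵥ (w - z)) l) ^ 2 = 0 :=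
    le_antisymm (by linarith [hw z]) (Finset.sum_nonneg fun _ _ => sq_nonneg _)
  rw [Finset.sum_eq_zero_iff_of_nonneg fun _ _ => sq_nonneg _] at h3
  funext l
  have := h3 l (Finset.mem_univ l)
  rw [sq_eq_zero_iff, Matrix.mulVec_sub, Pi.sub_apply] at this
  linarith

lemma corr_congr {w : Fin n → ℝ} (h : Matrix.of D *ᵥ w = Matrix.of D *ᵥ z) :
    corr y D w = corr y D z := by
  rw [corr, corr, h]

/-- If the columns in the support of a solution are linearly dependent, there is a solution with
smaller support. -/
theorem IsLassoSol.exists_support_ssubset (hlam : 0 ≤ lam) (h : IsLassoSol y lam D z)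
    {c : Fin n → ℝ} (hc : c ≠ 0) (hcz : ∀ j, z j = 0 → c j = 0) (hD : Matrix.of D *ᵥ c = 0) :
    ∃ w, IsLassoSol y lam D w ∧ Function.support w ⊂ Function.support z := by
  obtain ⟨j₁, hj₁⟩ := Function.ne_iff.1 hc
  obtain ⟨j, hj, hmin⟩ := (Finset.univ.filter fun j => c j ≠ 0).exists_min_image
    (fun j => |z j| / |c j|) ⟨j₁, by simpa using hj₁⟩
  have hcj : c j ≠ 0 := by simpa using hj
  have hzj : z j ≠ 0 := fun h0 => hcj (hcz j h0)
  -- As `j` minimises `|z j| / |c j|`, moving from `z` along `c` by this amount cancels coordinate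
  -- `j` before any coordinate changes sign. Fit and signs are kept, hence optimality.
  set t : ℝ := -(z j / c j) with ht
  have hle : ∀ i, |t * c i| ≤ |z i| := by
    intro i
    rcases eq_or_ne (c i) 0 with hi | hi
    · simp [hi]
    · have := hmin i (by simpa using hi)
      rw [ht, abs_mul, abs_neg, abs_div]
      exact (le_div_iff₀ (abs_pos.2 hi)).1 this
  have hfit : Matrix.of D *ᵥ (z + t • c) = Matrix.of D *ᵥ z := by
    rw [Matrix.mulVec_add, Matrix.mulVec_smul, hD, smul_zero, add_zero]
  refine ⟨z + t • c, (isLassoSol_iff hlam).2 fun i => ?_, ?_⟩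
  · rw [corr_congr hfit]
    refine ⟨h.abs_corr_le hlam i, ?_⟩
    have h1 := h.corr_mul hlam i
    have h2 := hle i
    simp only [Pi.add_apply, Pi.smul_apply, smul_eq_mul]
    rcases lt_trichotomy (z i) 0 with hz | hz | hz
    · rw [abs_of_neg hz] at h1 h2
      rw [abs_of_nonpos (by linarith [(abs_le.1 h2).2])]
      have : corr y D z i = -lam := mul_right_cancel₀ hz.ne (by linarith)
      rw [this]; ring
    · have : t * c i = 0 := abs_nonpos_iff.1 (by simpa only [hz, abs_zero] using h2)
      simp [hz, this]
    · rw [abs_of_pos hz] at h1 h2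
      rw [abs_of_nonneg (by linarith [(abs_le.1 h2).1])]
      have : corr y D z i = lam := mul_right_cancel₀ hz.ne' (by linarith)
      rw [this]
  · have hsub : Function.support (z + t • c) ⊆ Function.support z := by
      intro i hi hz
      exact hi (by simp [hz, hcz i hz])
    refine (Set.ssubset_iff_of_subset hsub).2 ⟨j, hzj, ?_⟩
    have : z j + -(z j / c j) * c j = 0 := by field_simp; ring
    simpa [ht] using this

lemma IsLassoSol.eq_zero_of_existsUnique (hlam : 0 ≤ lam) (h : IsLassoSol y lam D z)
    (hu : ∃! w, IsLassoSol y lam D w) {c : Fin n → ℝ} (hcz : ∀ j, z j = 0 → c j = 0)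
    (hD : Matrix.of D *ᵥ c = 0) : c = 0 := by
  by_contra hc
  obtain ⟨w, hw, hwz⟩ := h.exists_support_ssubset hlam hc hcz hD
  rw [hu.unique hw h] at hwz
  exact hwz.ne rfl

/-- A solution with minimal support works, since a dependency among its support columns would allow
the support to shrink. -/
lemma IsLassoSol.exists_injective_support (hlam : 0 ≤ lam) (h : IsLassoSol y lam D z) :
    ∃ w, IsLassoSol y lam D w ∧
      ∀ c : Fin n → ℝ, (∀ j, w j = 0 → c j = 0) → Matrix.of D *ᵥ c = 0 → c = 0 := by
  have hwf : WellFounded fun s t : Set (Fin n) => s ⊂ t := wellFounded_lt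
  obtain ⟨w, hw, hmin⟩ := (InvImage.wf (Function.support : (Fin n → ℝ) → Set (Fin n)) hwf).has_min
    {w | IsLassoSol y lam D w} ⟨z, h⟩
  refine ⟨w, hw, fun c hcw hD => ?_⟩
  by_contra hc
  obtain ⟨w', hw', hlt⟩ := hw.exists_support_ssubset hlam hc hcw hD
  exact hmin w' hw' hlt

/-- Monotonicity of the optimality conditions, for two dictionaries. -/
lemma IsLassoSol.sum_sq_mulVec_sub_le (hlam : 0 ≤ lam) {D' : Dict m n} {z' : Fin n → ℝ}
    (h : IsLassoSol y lam D z) (h' : IsLassoSol y lam D' z') :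
    ∑ l, ((Matrix.of D' *ᵥ (z - z')) l) ^ 2
      ≤ (corr y D z - corr y D' z) ⬝ᵥ (z - z') := by
  have h1 : corr y D' z - corr y D' z'
      = - ((Matrix.of D')ᵀ *ᵥ (Matrix.of D' *ᵥ (z - z'))) := by
    rw [corr, corr, ← Matrix.mulVec_sub, ← Matrix.mulVec_neg, sub_sub_sub_cancel_left,
      ← Matrix.mulVec_sub, ← Matrix.mulVec_neg, neg_sub]
  have h2 : (corr y D' z - corr y D' z') ⬝ᵥ (z - z')
      = - ∑ l, ((Matrix.of D' *ᵥ (z - z')) l) ^ 2 := by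
    rw [h1, neg_dotProduct, transpose_mulVec_dotProduct]
    simp [dotProduct, sq]
  -- The correlations are subgradients of `lam * ‖·‖₁` at the respective solutions, and subgradients
  -- are monotone.
  have h3 : 0 ≤ (corr y D z - corr y D' z') ⬝ᵥ (z - z') := by
    refine Finset.sum_nonneg fun j _ => ?_
    have a := h.corr_mul hlam j
    have b := h'.corr_mul hlam j
    have a' := mul_abs_sub_mul_nonneg (h.abs_corr_le hlam j) (z' j)
    have b' := mul_abs_sub_mul_nonneg (h'.abs_corr_le hlam j) (z j)
    simp only [Pi.sub_apply]
    nlinarith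
  have h4 : (corr y D z - corr y D' z) ⬝ᵥ (z - z')
      = (corr y D z - corr y D' z') ⬝ᵥ (z - z') - (corr y D' z - corr y D' z') ⬝ᵥ (z - z') := by
    rw [← sub_dotProduct]; congr 1; abel
  linarith

/-- Comparison with the zero vector. The bound does not depend on `D`, so solutions at nearby
dictionaries stay in one compact ball. -/
lemma IsLassoSol.norm_le (hlam : 0 < lam) (h : IsLassoSol y lam D z) :
    ‖z‖ ≤ (1 / 2) * (∑ l, y l ^ 2) / lam := by
  have h0 := h 0
  have h1 : lassoObj y lam 0 D = (1 / 2) * ∑ l, y l ^ 2 := by simp [lassoObj, dataFit]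
  have h2 : lam * ∑ i, |z i| ≤ (1 / 2) * ∑ l, y l ^ 2 := by
    rw [h1, lassoObj] at h0
    have : 0 ≤ dataFit y z D := by unfold dataFit; positivity
    linarith
  have h3 : ‖z‖ ≤ ∑ i, |z i| := by
    rw [pi_norm_le_iff_of_nonneg (by positivity)]
    intro i
    exact Finset.single_le_sum (f := fun i => |z i|) (fun _ _ => abs_nonneg _) (Finset.mem_univ i)
  rw [le_div_iff₀ hlam]
  nlinarith

end Optimality

/-! ### Stability of solutions under perturbation of the dictionary. -/

section Stability

variable {m n : ℕ} {y : Fin m → ℝ} {lam : ℝ}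

lemma abs_dotProduct_le {k : ℕ} (a b : Fin k → ℝ) : |a ⬝ᵥ b| ≤ k * (‖a‖ * ‖b‖) := by
  calc |a ⬝ᵥ b| ≤ ∑ i, |a i * b i| := Finset.abs_sum_le_sum_abs _ _
    _ ≤ ∑ _i : Fin k, ‖a‖ * ‖b‖ := by
        refine Finset.sum_le_sum fun i _ => ?_
        rw [abs_mul]
        exact mul_le_mul (norm_le_pi_norm a i) (norm_le_pi_norm b i) (abs_nonneg _) (norm_nonneg _)
    _ = k * (‖a‖ * ‖b‖) := by simp

lemma norm_mulVec_le (D : Dict m n) (c : Fin n → ℝ) :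
    ‖Matrix.of D *ᵥ c‖ ≤ n * (‖D‖ * ‖c‖) := by
  rw [pi_norm_le_iff_of_nonneg (by positivity)]
  intro l
  refine (abs_dotProduct_le (D l) c).trans ?_
  gcongr
  exact norm_le_pi_norm D l

lemma sq_norm_le_sum_sq {k : ℕ} (a : Fin k → ℝ) : ‖a‖ ^ 2 ≤ ∑ i, a i ^ 2 := by
  have h : ‖a‖ ≤ Real.sqrt (∑ i, a i ^ 2) := by
    rw [pi_norm_le_iff_of_nonneg (Real.sqrt_nonneg _)]
    intro i
    refine Real.le_sqrt_of_sq_le ?_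
    rw [Real.norm_eq_abs, sq_abs]
    exact Finset.single_le_sum (f := fun i => a i ^ 2) (fun _ _ => sq_nonneg _) (Finset.mem_univ i)
  calc ‖a‖ ^ 2 ≤ Real.sqrt (∑ i, a i ^ 2) ^ 2 := by gcongr
    _ = _ := Real.sq_sqrt (by positivity)

/-- Injectivity of a dictionary on the vectors with given support is quantitatively stable. -/
lemma eventually_le_norm_mulVec {D₀ : Dict m n} {p : Fin n → Prop}
    (h : ∀ c : Fin n → ℝ, (∀ j, p j → c j = 0) → Matrix.of D₀ *ᵥ c = 0 → c = 0) :
    ∃ μ : ℝ, 0 < μ ∧ ∀ᶠ D in 𝓝 D₀, ∀ c : Fin n → ℝ, (∀ j, p j → c j = 0) →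
      μ * ‖c‖ ≤ ‖Matrix.of D *ᵥ c‖ := by
  let W : Submodule ℝ (Fin n → ℝ) :=
    { carrier := {c | ∀ j, p j → c j = 0}
      add_mem' := fun ha hb j hj => by simp [ha j hj, hb j hj]
      zero_mem' := fun j _ => rfl
      smul_mem' := fun a c hc j hj => by simp [hc j hj] }
  obtain ⟨K, hK, hanti⟩ := LinearMap.exists_antilipschitzWith
    ((Matrix.mulVecLin (Matrix.of D₀)).domRestrict W) (by
      rw [LinearMap.ker_eq_bot']
      rintro ⟨c, hc⟩ h0
      exact Subtype.ext (h c hc h0))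
  have hK' : (0 : ℝ) < K := hK
  refine ⟨(K : ℝ)⁻¹ / 2, by positivity, ?_⟩
  have hlim : Tendsto (fun D : Dict m n => (n : ℝ) * ‖D - D₀‖) (𝓝 D₀) (𝓝 0) := by
    have : Continuous fun D : Dict m n => (n : ℝ) * ‖D - D₀‖ := by fun_prop
    simpa using this.tendsto D₀
  filter_upwards [hlim.eventually (gt_mem_nhds (show (0 : ℝ) < (K : ℝ)⁻¹ / 2 by positivity))]
    with D hD c hc
  have h1 : ‖c‖ ≤ K * ‖Matrix.of D₀ *ᵥ c‖ := by
    have := hanti.le_mul_norm_sub (⟨c, hc⟩ : W) 0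
    simpa using this
  have h2 : (K : ℝ)⁻¹ * ‖c‖ ≤ ‖Matrix.of D₀ *ᵥ c‖ := by
    rw [inv_mul_le_iff₀ hK']; exact h1
  have h3 : ‖Matrix.of D₀ *ᵥ c‖ ≤ ‖Matrix.of D *ᵥ c‖ + n * (‖D - D₀‖ * ‖c‖) := by
    have e : Matrix.of D₀ *ᵥ c = Matrix.of D *ᵥ c - Matrix.of (D - D₀) *ᵥ c := by
      rw [← Matrix.of_sub_of, Matrix.sub_mulVec]; abel
    rw [e]
    exact (norm_sub_le _ _).trans (by gcongr; exact norm_mulVec_le _ _)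
  have h4 : n * ‖D - D₀‖ * ‖c‖ ≤ (K : ℝ)⁻¹ / 2 * ‖c‖ := by gcongr
  linarith

/-- `corr` is smooth in the pair `(D, z)`, hence Lipschitz on a compact convex product of balls. -/
lemma exists_norm_corr_sub_le (y : Fin m → ℝ) (D₀ : Dict m n) (R : ℝ) :
    ∃ K : ℝ, 0 ≤ K ∧ ∀ D ∈ Metric.closedBall D₀ 1, ∀ D' ∈ Metric.closedBall D₀ 1, ∀ z, ‖z‖ ≤ R →
      ‖corr y D z - corr y D' z‖ ≤ K * ‖D - D'‖ := by
  obtain ⟨K, hK⟩ := (contDiff_corr (n := n) y).contDiffOn.exists_lipschitzOnWith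
    (s := Metric.closedBall D₀ 1 ×ˢ Metric.closedBall (0 : Fin n → ℝ) R) (by simp)
    ((convex_closedBall _ _).prod (convex_closedBall _ _))
    ((isCompact_closedBall _ _).prod (isCompact_closedBall _ _))
  refine ⟨K, K.2, fun D hD D' hD' z hz => ?_⟩
  have := hK.norm_sub_le (x := (D, z)) (y := (D', z)) ⟨hD, by simpa using hz⟩
    ⟨hD', by simpa using hz⟩
  simpa [Prod.norm_def] using this

/-- The correlations at the solution depend continuously on the dictionary. -/
lemma IsLassoSol.eventually_norm_corr_sub_lt (hlam : 0 < lam) {D₀ : Dict m n} {z₀ : Fin n → ℝ}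
    (h₀ : IsLassoSol y lam D₀ z₀) {ε : ℝ} (hε : 0 < ε) :
    ∀ᶠ D in 𝓝 D₀, ∀ z, IsLassoSol y lam D z → ‖corr y D z - corr y D₀ z₀‖ < ε := by
  set R : ℝ := (1 / 2) * (∑ l, y l ^ 2) / lam with hR
  obtain ⟨K, hK0, hK⟩ := exists_norm_corr_sub_le y D₀ R
  set B : Dict n m := fun i l => D₀ l i with hB
  have hlim : Tendsto (fun D : Dict m n => K * ‖D - D₀‖ + m * (‖B‖ *
      Real.sqrt (n * ((K * ‖D - D₀‖) * (R + R))))) (𝓝 D₀) (𝓝 0) := by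
    have : Continuous fun D : Dict m n => K * ‖D - D₀‖ + m * (‖B‖ *
      Real.sqrt (n * ((K * ‖D - D₀‖) * (R + R)))) := by fun_prop
    simpa using this.tendsto D₀
  filter_upwards [hlim.eventually (gt_mem_nhds hε), Metric.closedBall_mem_nhds D₀ one_pos]
    with D hD hball z hz
  have hzR := hz.norm_le hlam
  have h1 := hK D hball D₀ (Metric.mem_closedBall_self zero_le_one) z hzR
  -- Monotonicity is used with `D₀` in the role of `D'`, so that the fit is controlled without any
  -- injectivity. The price is a square root in the modulus of continuity.
  have h2 : ‖Matrix.of D₀ *ᵥ (z - z₀)‖ ≤ Real.sqrt (n * ((K * ‖D - D₀‖) * (R + R))) := by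
    refine Real.le_sqrt_of_sq_le ((sq_norm_le_sum_sq _).trans
      ((hz.sum_sq_mulVec_sub_le hlam.le h₀).trans ((le_abs_self _).trans
        ((abs_dotProduct_le _ _).trans ?_))))
    gcongr
    exact (norm_sub_le _ _).trans (add_le_add hzR (h₀.norm_le hlam))
  have h3 : corr y D z - corr y D₀ z₀
      = (corr y D z - corr y D₀ z) - Matrix.of B *ᵥ (Matrix.of D₀ *ᵥ (z - z₀)) := by
    have e : Matrix.of B = (Matrix.of D₀)ᵀ := rfl
    simp only [corr, e, Matrix.mulVec_sub]; abel
  have h4 : ‖Matrix.of B *ᵥ (Matrix.of D₀ *ᵥ (z - z₀))‖ ≤ m * (‖B‖ *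
      Real.sqrt (n * ((K * ‖D - D₀‖) * (R + R)))) := by
    refine (norm_mulVec_le B _).trans ?_
    gcongr
  rw [h3]
  exact ((norm_sub_le _ _).trans (add_le_add h1 h4)).trans_lt hD

/-- The dictionary is injective on the vectors supported in the equicorrelation set. -/
def EquiInjective (y : Fin m → ℝ) (lam : ℝ) (D : Dict m n) (z : Fin n → ℝ) : Prop :=
  ∀ c : Fin n → ℝ, (∀ j, |corr y D z j| < lam → c j = 0) → Matrix.of D *ᵥ c = 0 → c = 0

/-- Near a dictionary which is injective on the equicorrelation set, Lasso solutions are unique and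
depend on the dictionary in a Lipschitz way. -/
theorem EquiInjective.exists_lipschitz (hlam : 0 < lam) {D₀ : Dict m n} {z₀ : Fin n → ℝ}
    (h₀ : IsLassoSol y lam D₀ z₀) (hinj : EquiInjective y lam D₀ z₀) :
    ∃ K : NNReal, ∀ᶠ t in (𝓝 D₀).smallSets, ∀ D ∈ t, ∀ D' ∈ t, ∀ z z', IsLassoSol y lam D z →
      IsLassoSol y lam D' z' → ‖z - z'‖ ≤ K * ‖D - D'‖ := by
  set R : ℝ := (1 / 2) * (∑ l, y l ^ 2) / lam with hR
  obtain ⟨K, hK0, hK⟩ := exists_norm_corr_sub_le y D₀ R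
  obtain ⟨μ, hμ, hinj'⟩ := eventually_le_norm_mulVec hinj
  -- By continuity of the correlations, solutions near `D₀` vanish off the equicorrelation set of
  -- `D₀`, so differences of two of them lie where `D'` is injective with constant `μ`.
  have hsupp : ∀ᶠ D in 𝓝 D₀, ∀ z, IsLassoSol y lam D z →
      ∀ j, |corr y D₀ z₀ j| < lam → z j = 0 := by
    have : ∀ j, ∀ᶠ D in 𝓝 D₀, ∀ z, IsLassoSol y lam D z → |corr y D₀ z₀ j| < lam → z j = 0 := by
      intro j
      by_cases hj : |corr y D₀ z₀ j| < lam
      · filter_upwards [h₀.eventually_norm_corr_sub_lt hlam (sub_pos.2 hj)] with D hD z hz _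
        refine hz.eq_zero_of_abs_corr_lt hlam.le ?_
        have h1 := (norm_le_pi_norm (corr y D z - corr y D₀ z₀) j).trans_lt (hD z hz)
        have h2 := abs_sub_abs_le_abs_sub (corr y D z j) (corr y D₀ z₀ j)
        rw [Pi.sub_apply, Real.norm_eq_abs] at h1
        linarith
      · exact Eventually.of_forall fun D z _ h => absurd h hj
    filter_upwards [eventually_all.2 this] with D hD z hz j using hD j z hz
  -- The constant comes from `(μ ‖z - z'‖)² ≤ n K ‖D - D'‖ ‖z - z'‖` after division by `μ² ‖z -
  -- z'‖`.
  refine ⟨⟨n * K / μ ^ 2, by positivity⟩, ?_⟩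
  have hall := (hinj'.and (hsupp.and (Metric.closedBall_mem_nhds D₀ one_pos)))
  rw [eventually_smallSets]
  refine ⟨_, hall, fun t ht D hD D' hD' z z' hz hz' => ?_⟩
  obtain ⟨-, hs, hb⟩ := ht hD
  obtain ⟨hi', hs', hb'⟩ := ht hD'
  have h1 : μ * ‖z - z'‖ ≤ ‖Matrix.of D' *ᵥ (z - z')‖ :=
    hi' _ fun j hj => by simp [hs z hz j hj, hs' z' hz' j hj]
  have h2 : ‖Matrix.of D' *ᵥ (z - z')‖ ^ 2 ≤ n * ((K * ‖D - D'‖) * ‖z - z'‖) := by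
    refine (sq_norm_le_sum_sq _).trans ((hz.sum_sq_mulVec_sub_le hlam.le hz').trans
      ((le_abs_self _).trans ((abs_dotProduct_le _ _).trans ?_)))
    gcongr
    exact hK D hb D' hb' z (hz.norm_le hlam)
  have h3 : (μ * ‖z - z'‖) ^ 2 ≤ n * ((K * ‖D - D'‖) * ‖z - z'‖) :=
    (pow_le_pow_left₀ (by positivity) h1 2).trans h2
  show ‖z - z'‖ ≤ n * K / μ ^ 2 * ‖D - D'‖
  rcases (norm_nonneg (z - z')).eq_or_lt with h0 | h0
  · rw [← h0]; positivity
  · rw [div_mul_eq_mul_div, le_div_iff₀ (by positivity)]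
    refine le_of_mul_le_mul_right ?_ h0
    linarith

variable {zs : Dict m n → Fin n → ℝ}

/-- The Lipschitz estimate with `D = D'` forces two solutions at the same nearby dictionary to
coincide. -/
lemma EquiInjective.mem_uniqueDomain (hlam : 0 < lam) {D₀ : Dict m n}
    (hzs : ∀ D, IsLassoSol y lam D (zs D)) (hinj : EquiInjective y lam D₀ (zs D₀)) :
    D₀ ∈ uniqueDomain n y lam := by
  obtain ⟨K, hK⟩ := hinj.exists_lipschitz hlam (hzs D₀)
  obtain ⟨t, ht, htK⟩ := eventually_smallSets.1 hK
  rw [uniqueDomain, mem_interior_iff_mem_nhds]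
  filter_upwards [ht] with D hD
  refine ⟨zs D, hzs D, fun w hw => ?_⟩
  have := htK t subset_rfl D hD D hD w (zs D) hw (hzs D)
  rw [sub_self, norm_zero, mul_zero] at this
  exact sub_eq_zero.1 (norm_le_zero_iff.1 this)

lemma EquiInjective.exists_lipschitzOnWith (hlam : 0 < lam) {D₀ : Dict m n}
    (hzs : ∀ D, IsLassoSol y lam D (zs D)) (hinj : EquiInjective y lam D₀ (zs D₀)) :
    ∃ K : NNReal, ∃ t ∈ 𝓝 D₀, LipschitzOnWith K zs t := by
  obtain ⟨K, hK⟩ := hinj.exists_lipschitz hlam (hzs D₀)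
  obtain ⟨t, ht, htK⟩ := eventually_smallSets.1 hK
  refine ⟨K, t, ht, LipschitzOnWith.of_dist_le_mul fun D hD D' hD' => ?_⟩
  rw [dist_eq_norm, dist_eq_norm]
  exact htK t subset_rfl D hD D' hD' _ _ (hzs D) (hzs D')

end Stability

/-! ### Injectivity on the equicorrelation set throughout the interior of uniqueness. -/

section UniqueDomain

variable {m n : ℕ} {y : Fin m → ℝ} {lam : ℝ}

lemma isLassoSol_of_sign (hlam : 0 ≤ lam) {D : Dict m n} {z s : Fin n → ℝ}
    (hle : ∀ j, |corr y D z j| ≤ lam) (hs : ∀ j, z j ≠ 0 → |s j| = 1 ∧ corr y D z j = lam * s j)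
    (hpos : ∀ j, 0 ≤ s j * z j) : IsLassoSol y lam D z := by
  refine (isLassoSol_iff hlam).2 fun j => ⟨hle j, ?_⟩
  rcases eq_or_ne (z j) 0 with h | h
  · simp [h]
  · rw [(hs j h).2, mul_assoc, ← abs_of_nonneg (hpos j), abs_mul, (hs j h).1, one_mul]

/-- The signs of the correlations on the equicorrelation set, and zero elsewhere. -/
lemma exists_equicorrelation_signs (hlam : 0 < lam) {D : Dict m n} {z : Fin n → ℝ}
    (h : IsLassoSol y lam D z) : ∃ s : Fin n → ℝ,
      (∀ j, |corr y D z j| < lam → s j = 0) ∧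
      (∀ j, ¬ |corr y D z j| < lam → |s j| = 1 ∧ corr y D z j = lam * s j) ∧
      ∀ j, s j * z j = |z j| := by
  classical
  refine ⟨fun j => if |corr y D z j| < lam then 0 else corr y D z j / lam, fun j hj => if_pos hj,
    fun j hj => ?_, fun j => ?_⟩
  · simp only [if_neg hj]
    have : |corr y D z j| = lam := le_antisymm (h.abs_corr_le hlam.le j) (not_lt.1 hj)
    exact ⟨by rw [abs_div, this, abs_of_pos hlam, div_self hlam.ne'], by field_simp⟩
  · by_cases hj : |corr y D z j| < lam
    · simp [hj, h.eq_zero_of_abs_corr_lt hlam.le hj]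
    · simp only [if_neg hj]
      rw [div_mul_eq_mul_div, h.corr_mul hlam.le, mul_div_cancel_left₀ _ hlam.ne']

/-- Here the support of `z` is that of `s`, so the kernel vector `c` lives on the support of a
solution, which uniqueness rules out. -/
lemma not_existsUnique_of_sign (hlam : 0 ≤ lam) {D : Dict m n} {z s c : Fin n → ℝ}
    (hle : ∀ j, |corr y D z j| ≤ lam) (hs : ∀ j, s j ≠ 0 → |s j| = 1 ∧ corr y D z j = lam * s j)
    (hpos : ∀ j, s j ≠ 0 → 0 < s j * z j) (hz : ∀ j, s j = 0 → z j = 0)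
    (hc : c ≠ 0) (hcs : ∀ j, s j = 0 → c j = 0) (hD : Matrix.of D *ᵥ c = 0) :
    ¬ ∃! w, IsLassoSol y lam D w := by
  have hzs : ∀ j, z j = 0 → s j = 0 := by
    intro j hj
    by_contra h
    simpa [hj] using hpos j h
  have hsol : IsLassoSol y lam D z := by
    refine isLassoSol_of_sign hlam hle (s := s) (fun j hj => hs j fun h => hj (hz j h)) fun j => ?_
    rcases eq_or_ne (s j) 0 with h | h
    · simp [h]
    · exact (hpos j h).le
  intro hu
  exact hc (hsol.eq_zero_of_existsUnique hlam hu (fun j hj => hcs j (hzs j hj)) hD)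

/-- Rank-one modification of a dictionary. -/
lemma of_add_vecMulVec_mulVec (D : Dict m n) (a : Fin m → ℝ) (b x : Fin n → ℝ) :
    Matrix.of (fun l k => D l k + a l * b k) *ᵥ x = Matrix.of D *ᵥ x + (b ⬝ᵥ x) • a := by
  have : Matrix.of (fun l k => D l k + a l * b k) = Matrix.of D + Matrix.vecMulVec a b := by
    ext l k; simp [Matrix.vecMulVec_apply]
  rw [this, Matrix.add_mulVec, Matrix.vecMulVec_mulVec]
  simp

lemma of_add_vecMulVec_transpose_mulVec (D : Dict m n) (a r : Fin m → ℝ) (b : Fin n → ℝ) :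
    (Matrix.of fun l k => D l k + a l * b k)ᵀ *ᵥ r = (Matrix.of D)ᵀ *ᵥ r + (a ⬝ᵥ r) • b := by
  have : Matrix.of (fun l k => D l k + a l * b k) = Matrix.of D + Matrix.vecMulVec a b := by
    ext l k; simp [Matrix.vecMulVec_apply]
  rw [this, Matrix.transpose_add, Matrix.transpose_vecMulVec, Matrix.add_mulVec,
    Matrix.vecMulVec_mulVec]
  simp

lemma dotProduct_self_eq_sum_sq {k : ℕ} (a : Fin k → ℝ) : a ⬝ᵥ a = ∑ i, a i ^ 2 := by
  simp [dotProduct, sq]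

variable {D : Dict m n} {z s c : Fin n → ℝ}

/-- If the solution is nonzero and the dictionary is not injective on the equicorrelation set, there
are arbitrarily close dictionaries with several solutions. -/
lemma exists_path_of_ne_zero (hlam : 0 < lam) (h : IsLassoSol y lam D z) (hz0 : z ≠ 0)
    (hs0 : ∀ j, |corr y D z j| < lam → s j = 0)
    (hs1 : ∀ j, ¬ |corr y D z j| < lam → |s j| = 1 ∧ corr y D z j = lam * s j)
    (hsz : ∀ j, s j * z j = |z j|) (hc : c ≠ 0) (hcs : ∀ j, |corr y D z j| < lam → c j = 0)
    (hDc : Matrix.of D *ᵥ c = 0) (hsc : s ⬝ᵥ c = 0) :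
    ∃ γ : ℝ → Dict m n, ContinuousAt γ 0 ∧ γ 0 = D ∧
      ∀ᶠ ε in 𝓝[>] (0 : ℝ), ¬ ∃! w, IsLassoSol y lam (γ ε) w := by
  set g := corr y D z with hg
  set ℓ : ℝ := s ⬝ᵥ z with hℓ
  have hℓ' : ℓ = ∑ j, |z j| := Finset.sum_congr rfl fun j _ => hsz j
  have hℓ0 : 0 < ℓ := by
    obtain ⟨j, hj⟩ := Function.ne_iff.1 hz0
    rw [hℓ']
    exact Finset.sum_pos' (fun _ _ => abs_nonneg _) ⟨j, Finset.mem_univ j, abs_pos.2 hj⟩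
  set ν : ℝ := s ⬝ᵥ s with hν
  have hν0 : 0 < ν := by
    obtain ⟨j, hj⟩ := Function.ne_iff.1 hz0
    have hsj : s j ≠ 0 := fun h0 => by
      have := hsz j
      rw [h0, zero_mul] at this
      exact hj (abs_eq_zero.1 this.symm)
    rw [hν, dotProduct_self_eq_sum_sq]
    exact Finset.sum_pos' (fun _ _ => sq_nonneg _) ⟨j, Finset.mem_univ j, by positivity⟩
  have hgs : ∀ x : Fin n → ℝ, (∀ j, |g j| < lam → x j = 0) → g ⬝ᵥ x = lam * (s ⬝ᵥ x) := by
    intro x hx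
    rw [dotProduct, dotProduct, Finset.mul_sum]
    refine Finset.sum_congr rfl fun j _ => ?_
    by_cases hj : |g j| < lam
    · simp [hx j hj]
    · rw [(hs1 j hj).2]; ring
  -- Moving from `z` along `d` goes towards a positive multiple of `s`, which makes every
  -- equicorrelated coordinate nonzero with the right sign. The multiple is chosen so that `d` is
  -- orthogonal to `s`, hence also to `g`.
  set d : Fin n → ℝ := (ℓ / ν) • s - z with hd
  have hsd : s ⬝ᵥ d = 0 := by
    rw [hd, dotProduct_sub, dotProduct_smul, smul_eq_mul, ← hν, ← hℓ]
    field_simp; ring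
  have hgd : g ⬝ᵥ d = 0 := by
    rw [hgs d fun j hj => ?_, hsd, mul_zero]
    simp [hd, hs0 j hj, h.eq_zero_of_abs_corr_lt hlam.le hj]
  -- The rank-one term `-(ε / ℓ) (D d) sᵀ` cancels the change `ε D d` of the fit, because `s ⬝ᵥ (z +
  -- ε • d) = ℓ`. It leaves the correlations unchanged because `D d` is orthogonal to the residual,
  -- and it kills `c` because `s ⬝ᵥ c = 0`.
  refine ⟨fun ε l k => D l k + (-(ε / ℓ) • (Matrix.of D *ᵥ d)) l * s k, ?_, ?_, ?_⟩
  · refine Continuous.continuousAt ?_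
    refine continuous_pi fun l => continuous_pi fun k => ?_
    simp only [Pi.smul_apply, smul_eq_mul]
    fun_prop
  · funext l k; simp
  · filter_upwards [Ioo_mem_nhdsGT (zero_lt_one (α := ℝ))] with ε hε
    have hfit : Matrix.of (fun l k => D l k + (-(ε / ℓ) • (Matrix.of D *ᵥ d)) l * s k) *ᵥ
        (z + ε • d) = Matrix.of D *ᵥ z := by
      rw [of_add_vecMulVec_mulVec, dotProduct_add, dotProduct_smul, hsd, ← hℓ, Matrix.mulVec_add,
        Matrix.mulVec_smul, smul_zero, add_zero, smul_smul]
      have : ℓ * -(ε / ℓ) = -ε := by field_simp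
      rw [this, neg_smul, add_neg_cancel_right]
    have hcorr : corr y (fun l k => D l k + (-(ε / ℓ) • (Matrix.of D *ᵥ d)) l * s k)
        (z + ε • d) = g := by
      have h0 : (Matrix.of D *ᵥ d) ⬝ᵥ (y - Matrix.of D *ᵥ z) = 0 := by
        rw [dotProduct_comm, ← transpose_mulVec_dotProduct]; exact hgd
      rw [corr, hfit, of_add_vecMulVec_transpose_mulVec, smul_dotProduct, h0, smul_zero, zero_smul,
        add_zero, hg, corr]
    refine not_existsUnique_of_sign hlam.le (z := z + ε • d) (s := s) (c := c)
      (fun j => by rw [hcorr]; exact h.abs_corr_le hlam.le j) (fun j hj => ?_) (fun j hj => ?_)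
      (fun j hj => ?_) hc (fun j hj => ?_) ?_
    · rw [hcorr]
      exact hs1 j fun h' => hj (hs0 j h')
    · have h1 : s j ^ 2 = 1 := by
        rw [← sq_abs, (hs1 j fun h' => hj (hs0 j h')).1, one_pow]
      have h2 : s j * (z + ε • d) j = (1 - ε) * (s j * z j) + ε * (ℓ / ν) * s j ^ 2 := by
        simp [hd]; ring
      rw [h2, hsz, h1, mul_one]
      have h3 : 0 < ε * (ℓ / ν) := mul_pos hε.1 (by positivity)
      have h4 : 0 ≤ (1 - ε) * |z j| := mul_nonneg (by linarith [hε.2]) (abs_nonneg _)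
      linarith
    · have : |z j| = 0 := by rw [← hsz, hj, zero_mul]
      simp [hd, hj, abs_eq_zero.1 this]
    · by_cases hj' : |g j| < lam
      · exact hcs j hj'
      · have := (hs1 j hj').1
        simp [hj] at this
    · rw [of_add_vecMulVec_mulVec, hDc, hsc, zero_smul, add_zero]

/-- The path of the nonzero case divides by `s ⬝ᵥ z`, which is zero here. Instead the solution `e κ
• s` is created with new fit `ρ κ = e κ • q + κ • y`, through the rank-one term `τ κ • y (Dᵀ ρ κ)ᵀ`.
Its row vector is orthogonal to every kernel vector of `D`. -/
lemma exists_path_of_zero (hlam : 0 < lam) (h : IsLassoSol y lam D 0)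
    (hs0 : ∀ j, |corr y D 0 j| < lam → s j = 0)
    (hs1 : ∀ j, ¬ |corr y D 0 j| < lam → |s j| = 1 ∧ corr y D 0 j = lam * s j)
    (hc : c ≠ 0) (hcs : ∀ j, |corr y D 0 j| < lam → c j = 0)
    (hDc : Matrix.of D *ᵥ c = 0) :
    ∃ γ : ℝ → Dict m n, ContinuousAt γ 0 ∧ γ 0 = D ∧
      ∀ᶠ ε in 𝓝[>] (0 : ℝ), ¬ ∃! w, IsLassoSol y lam (γ ε) w := by
  set g := corr y D 0 with hg
  have hgy : g = (Matrix.of D)ᵀ *ᵥ y := by simp [hg, corr]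
  have hs_ne : ∃ j, s j ≠ 0 := by
    obtain ⟨j, hj⟩ := Function.ne_iff.1 hc
    have := (hs1 j fun h' => hj (hcs j h')).1
    exact ⟨j, fun h0 => by simp [h0] at this⟩
  set q : Fin m → ℝ := Matrix.of D *ᵥ s with hq
  set p : ℝ := y ⬝ᵥ q with hp
  have hp0 : 0 < p := by
    have h1 : p = lam * ∑ j, s j ^ 2 := by
      rw [hp, hq, ← transpose_mulVec_dotProduct, ← hgy, dotProduct, Finset.mul_sum]
      refine Finset.sum_congr rfl fun j _ => ?_
      by_cases hj : |g j| < lam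
      · simp [hs0 j hj]
      · rw [(hs1 j hj).2]; ring
    obtain ⟨j, hj⟩ := hs_ne
    rw [h1]
    exact mul_pos hlam
      (Finset.sum_pos' (fun _ _ => sq_nonneg _) ⟨j, Finset.mem_univ j, by positivity⟩)
  set Y : ℝ := y ⬝ᵥ y with hY
  set Q : ℝ := q ⬝ᵥ q with hQ
  have hY0 : 0 < Y := by
    refine lt_of_le_of_ne (by rw [hY, dotProduct_self_eq_sum_sq]; positivity) fun h0 => hp0.ne' ?_
    rw [hp, dotProduct_self_eq_zero.1 h0.symm, zero_dotProduct]
  have hQ0 : 0 < Q := by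
    refine lt_of_le_of_ne (by rw [hQ, dotProduct_self_eq_sum_sq]; positivity) fun h0 => hp0.ne' ?_
    rw [hp, dotProduct_self_eq_zero.1 h0.symm, dotProduct_zero]
  -- `e κ` is the root of `Q e² + 2 κ p e = κ (1 - κ) Y` that is positive for `0 < κ < 1`; this
  -- equation says that the modified dictionary sends `e κ • s` to `ρ κ`.
  set e : ℝ → ℝ := fun κ => (-(κ * p) + Real.sqrt ((κ * p) ^ 2 + Q * (κ * (1 - κ) * Y))) / Q with he
  have hec : Continuous e := by rw [he]; fun_prop
  have he0 : e 0 = 0 := by simp [he]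
  set ρ : ℝ → Fin m → ℝ := fun κ => e κ • q + κ • y with hρ
  -- With this normalisation the correlations become `Dᵀ (y - ρ κ) + Dᵀ ρ κ = Dᵀ y`, the original
  -- ones.
  set τ : ℝ → ℝ := fun κ => (y ⬝ᵥ (y - ρ κ))⁻¹ with hτ
  have hden : ∀ κ, y ⬝ᵥ (y - ρ κ) = Y - e κ * p - κ * Y := by
    intro κ
    simp only [hρ, dotProduct_sub, dotProduct_add, dotProduct_smul, smul_eq_mul, ← hY, ← hp]
    ring
  have hdenc : Continuous fun κ => y ⬝ᵥ (y - ρ κ) := by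
    simp only [hden]; fun_prop
  have hden0 : y ⬝ᵥ (y - ρ 0) = Y := by rw [hden, he0]; ring
  refine ⟨fun κ l k => D l k + (τ κ • y) l * ((Matrix.of D)ᵀ *ᵥ ρ κ) k, ?_, ?_, ?_⟩
  · have hτc : ContinuousAt τ 0 := hdenc.continuousAt.inv₀ (by rw [hden0]; exact hY0.ne')
    have hρc : Continuous fun κ => (Matrix.of D)ᵀ *ᵥ ρ κ := by
      have : Continuous ρ := by rw [hρ]; fun_prop
      exact Continuous.matrix_mulVec continuous_const this
    refine continuousAt_pi.2 fun l => continuousAt_pi.2 fun k => ?_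
    simp only [Pi.smul_apply, smul_eq_mul]
    exact continuousAt_const.add ((hτc.mul continuousAt_const).mul
      ((continuous_apply k).comp hρc).continuousAt)
  · funext l k
    simp [hρ, he0]
  · have hev : ∀ᶠ κ in 𝓝[>] (0 : ℝ), y ⬝ᵥ (y - ρ κ) ≠ 0 :=
      (hdenc.continuousAt.eventually_ne (by rw [hden0]; exact hY0.ne')).filter_mono
        nhdsWithin_le_nhds
    filter_upwards [Ioo_mem_nhdsGT (zero_lt_one (α := ℝ)), hev] with κ hκ hne
    have hrad : 0 < Q * (κ * (1 - κ) * Y) :=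
      mul_pos hQ0 (mul_pos (mul_pos hκ.1 (by linarith [hκ.2])) hY0)
    have hκp : 0 < κ * p := mul_pos hκ.1 hp0
    have hepos : 0 < e κ := by
      refine div_pos ?_ hQ0
      have : κ * p < Real.sqrt ((κ * p) ^ 2 + Q * (κ * (1 - κ) * Y)) :=
        Real.lt_sqrt_of_sq_lt (by linarith)
      linarith
    have hequad : κ * (Y - e κ * p - κ * Y) = e κ * (e κ * Q + κ * p) := by
      have h1 : Q * e κ + κ * p = Real.sqrt ((κ * p) ^ 2 + Q * (κ * (1 - κ) * Y)) := by
        simp only [he]; field_simp; ring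
      have h2 : (Q * e κ + κ * p) ^ 2 = (κ * p) ^ 2 + Q * (κ * (1 - κ) * Y) := by
        rw [h1, Real.sq_sqrt (by positivity)]
      refine mul_left_cancel₀ hQ0.ne' ?_
      linarith
    have hρq : ρ κ ⬝ᵥ q = e κ * Q + κ * p := by
      simp only [hρ, add_dotProduct, smul_dotProduct, smul_eq_mul, ← hQ, ← hp]
    have hfit : Matrix.of (fun l k => D l k + (τ κ • y) l * ((Matrix.of D)ᵀ *ᵥ ρ κ) k) *ᵥ
        (e κ • s) = ρ κ := by
      rw [of_add_vecMulVec_mulVec, transpose_mulVec_dotProduct, Matrix.mulVec_smul, ← hq,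
        dotProduct_smul, hρq, smul_smul]
      simp only [hρ]
      congr 2
      rw [smul_eq_mul, ← hequad, ← hden]
      simp only [hτ]
      field_simp
    have hcorr : corr y (fun l k => D l k + (τ κ • y) l * ((Matrix.of D)ᵀ *ᵥ ρ κ) k)
        (e κ • s) = g := by
      rw [corr, hfit, of_add_vecMulVec_transpose_mulVec, smul_dotProduct, hgy, smul_eq_mul]
      have : τ κ * (y ⬝ᵥ (y - ρ κ)) = 1 := inv_mul_cancel₀ hne
      rw [this, one_smul, Matrix.mulVec_sub, sub_add_cancel]
    refine not_existsUnique_of_sign hlam.le (z := e κ • s) (s := s) (c := c)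
      (fun j => by rw [hcorr]; exact h.abs_corr_le hlam.le j) (fun j hj => ?_) (fun j hj => ?_)
      (fun j hj => by simp [hj]) hc (fun j hj => ?_) ?_
    · rw [hcorr]
      exact hs1 j fun h' => hj (hs0 j h')
    · have : s j * (e κ • s) j = e κ * s j ^ 2 := by simp; ring
      rw [this]
      positivity
    · by_cases hj' : |g j| < lam
      · exact hcs j hj'
      · have := (hs1 j hj').1
        simp [hj] at this
    · rw [of_add_vecMulVec_mulVec, transpose_mulVec_dotProduct, hDc, dotProduct_zero, zero_smul,
        add_zero]

/-- On the interior of the uniqueness set, the dictionary is injective on the equicorrelation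
set. -/
theorem equiInjective_of_mem_uniqueDomain (hlam : 0 < lam) (h : IsLassoSol y lam D z)
    (hD : D ∈ uniqueDomain n y lam) : EquiInjective y lam D z := by
  intro c hcs hDc
  by_contra hc
  obtain ⟨s, hs0, hs1, hsz⟩ := exists_equicorrelation_signs hlam h
  have hpath : ∃ γ : ℝ → Dict m n, ContinuousAt γ 0 ∧ γ 0 = D ∧
      ∀ᶠ ε in 𝓝[>] (0 : ℝ), ¬ ∃! w, IsLassoSol y lam (γ ε) w := by
    rcases eq_or_ne z 0 with rfl | hz
    · exact exists_path_of_zero hlam h hs0 hs1 hc hcs hDc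
    · refine exists_path_of_ne_zero hlam h hz hs0 hs1 hsz hc hcs hDc ?_
      have h1 : corr y D z ⬝ᵥ c = 0 := by
        rw [corr, transpose_mulVec_dotProduct, hDc, dotProduct_zero]
      have h2 : corr y D z ⬝ᵥ c = lam * (s ⬝ᵥ c) := by
        rw [dotProduct, dotProduct, Finset.mul_sum]
        refine Finset.sum_congr rfl fun j _ => ?_
        by_cases hj : |corr y D z j| < lam
        · simp [hcs j hj]
        · rw [(hs1 j hj).2]; ring
      exact (mul_eq_zero.1 (h2.symm.trans h1)).resolve_left hlam.ne'
  obtain ⟨γ, hγ, hγ0, hev⟩ := hpath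
  have hmem : ∀ᶠ ε in 𝓝[>] (0 : ℝ), γ ε ∈ {D | ∃! z, IsLassoSol y lam D z} := by
    refine (hγ.tendsto.mono_left nhdsWithin_le_nhds).eventually ?_
    rw [hγ0]
    exact mem_interior_iff_mem_nhds.1 hD
  obtain ⟨ε, h1, h2⟩ := (hev.and hmem).exists
  exact h1 h2

end UniqueDomain

/-! ### Nondegeneracy for almost every dictionary. -/

section Nondegenerate

variable {m n : ℕ} {y : Fin m → ℝ} {lam : ℝ} {D : Dict m n} {z : Fin n → ℝ}

/-- The support of `z` is linearly independent and strict complementarity holds. -/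
def Nondegenerate (y : Fin m → ℝ) (lam : ℝ) (D : Dict m n) (z : Fin n → ℝ) : Prop :=
  (∀ c : Fin n → ℝ, (∀ j, z j = 0 → c j = 0) → Matrix.of D *ᵥ c = 0 → c = 0) ∧
  ∀ j, z j = 0 → |corr y D z j| < lam

lemma Nondegenerate.equiInjective (h : Nondegenerate y lam D z) : EquiInjective y lam D z :=
  fun c hc hD => h.1 c (fun j hj => hc j (h.2 j hj)) hD

lemma Nondegenerate.eq (hlam : 0 < lam) (h : Nondegenerate y lam D z) (hz : IsLassoSol y lam D z)
    {w : Fin n → ℝ} (hw : IsLassoSol y lam D w) : w = z := by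
  have hfit := hz.mulVec_eq hlam.le hw
  refine sub_eq_zero.1 (h.1 (w - z) (fun j hj => ?_) ?_)
  · have : w j = 0 := hw.eq_zero_of_abs_corr_lt hlam.le (by rw [corr_congr hfit]; exact h.2 j hj)
    simp [this, hj]
  · rw [Matrix.mulVec_sub, hfit, sub_self]

/-- The Gram matrix of the columns of `M`, with ones added on the diagonal outside `S`. -/
def maskedGram (S : Finset (Fin n)) (M : Dict m n) : Matrix (Fin n) (Fin n) ℝ :=
  (Matrix.of M)ᵀ * Matrix.of M + Matrix.diagonal fun k => if k ∈ S then 0 else 1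

/-- The dictionary with the columns outside `S` set to zero. -/
def maskDict (S : Finset (Fin n)) (D : Dict m n) : Dict m n :=
  fun l k => if k ∈ S then D l k else 0

/-- The residual of the Lasso solution with support `S` and signs `s`, in terms of the columns in
the support only. -/
noncomputable def maskedResidual (y : Fin m → ℝ) (lam : ℝ) (S : Finset (Fin n)) (s : Fin n → ℝ)
    (M : Dict m n) :
    Fin m → ℝ :=
  y - Matrix.of M *ᵥ ((maskedGram S M)⁻¹ *ᵥ ((Matrix.of M)ᵀ *ᵥ y - lam • s))

lemma measurable_maskedResidual (y : Fin m → ℝ) (lam : ℝ) (S : Finset (Fin n)) (s : Fin n → ℝ)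
    (l : Fin m) : Measurable fun D : Dict m n => maskedResidual y lam S s (maskDict S D) l := by
  have hM : Continuous fun D : Dict m n => Matrix.of (maskDict S D) := by
    refine continuous_matrix fun l k => ?_
    by_cases hk : k ∈ S
    · simp only [maskDict, Matrix.of_apply, if_pos hk]; fun_prop
    · simp only [maskDict, Matrix.of_apply, if_neg hk]; fun_prop
  have hG : Continuous fun D : Dict m n => maskedGram S (maskDict S D) :=
    (hM.matrix_transpose.matrix_mul hM).add continuous_const
  -- Cramer's rule writes the inverse as a polynomial matrix over a determinant, which is measurable
  -- even where the determinant vanishes.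
  have e : (fun D : Dict m n => maskedResidual y lam S s (maskDict S D) l)
      = fun D : Dict m n => y l - ((maskedGram S (maskDict S D)).det)⁻¹ *
        (Matrix.of (maskDict S D) *ᵥ ((maskedGram S (maskDict S D)).adjugate *ᵥ
          ((Matrix.of (maskDict S D))ᵀ *ᵥ y - lam • s))) l := by
    funext D
    rw [maskedResidual, Matrix.inv_def, Ring.inverse_eq_inv', Matrix.smul_mulVec,
      Matrix.mulVec_smul]
    simp
  rw [e]
  have hv : Continuous fun D : Dict m n => (Matrix.of (maskDict S D) *ᵥ
      ((maskedGram S (maskDict S D)).adjugate *ᵥ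
        ((Matrix.of (maskDict S D))ᵀ *ᵥ y - lam • s))) := by
    refine hM.matrix_mulVec (hG.matrix_adjugate.matrix_mulVec ?_)
    exact (hM.matrix_transpose.matrix_mulVec continuous_const).sub continuous_const
  exact measurable_const.sub (hG.matrix_det.measurable.inv.mul
    ((continuous_apply l).comp hv).measurable)

/-- The residual ignores column `j`, so changing only the entry `D l j` moves the sum at a constant
nonzero speed and it takes the value `a` at most once on each such line. -/
lemma volume_maskedResidual_orthogonal (y : Fin m → ℝ) (lam : ℝ) (S : Finset (Fin n))
    (s : Fin n → ℝ) (a : ℝ) {j : Fin n} (hj : j ∉ S) (l : Fin m) :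
    volume {D : Dict m n | maskedResidual y lam S s (maskDict S D) l ≠ 0 ∧
      ∑ i, D i j * maskedResidual y lam S s (maskDict S D) i = a} = 0 := by
  set r : Dict m n → Fin m → ℝ := fun D => maskedResidual y lam S s (maskDict S D) with hr
  have hrm : ∀ l, Measurable fun D => r D l := measurable_maskedResidual y lam S s
  let v : Dict m n := Pi.single l (Pi.single j 1)
  -- The translates by `1 / (k + 1)` along the entry `(l, j)` form a bounded infinite family; once
  -- they are pairwise disjoint, the measurable set is null.
  refine Measure.addHaar_eq_zero_of_disjoint_translates volume
    (fun k : ℕ => ((1 : ℝ) / (k + 1)) • v) ?_ ?_ ?_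
  · refine Metric.isBounded_range_of_tendsto (x := (0 : ℝ) • v) _ ?_
    exact tendsto_one_div_add_atTop_nhds_zero_nat.smul_const v
  · intro k₁ k₂ hk
    refine Set.disjoint_left.2 ?_
    rintro x hx hx'
    simp only [Set.singleton_add, Set.mem_image] at hx hx'
    obtain ⟨D₁, ⟨h1, h1'⟩, e1⟩ := hx
    obtain ⟨D₂, ⟨h2, h2'⟩, e2⟩ := hx'
    have hne : (1 : ℝ) / (k₁ + 1) ≠ 1 / (k₂ + 1) := by
      intro h
      rw [one_div, one_div, inv_inj] at h
      exact hk (by exact_mod_cast add_right_cancel h)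
    have hD : D₂ = D₁ + ((1 : ℝ) / (k₁ + 1) - 1 / (k₂ + 1)) • v := by
      rw [sub_smul, ← add_sub_assoc, add_comm D₁, e1, ← e2, add_sub_cancel_left]
    have hmask : maskDict S D₂ = maskDict S D₁ := by
      funext i k
      by_cases hk : k ∈ S
      · have hkj : k ≠ j := fun h => hj (h ▸ hk)
        have hv : v i k = 0 := by
          rcases eq_or_ne i l with rfl | h
          · simp [v, hkj]
          · simp [v, h]
        simp [maskDict, hk, hD, hv]
      · simp [maskDict, hk]
    have hr' : r D₂ = r D₁ := by simp only [hr, hmask]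
    have hv : ∀ i, v i j = if i = l then 1 else 0 := by
      intro i
      rcases eq_or_ne i l with rfl | h
      · simp [v]
      · simp [v, h]
    change ∑ i, D₁ i j * r D₁ i = a at h1'
    change ∑ i, D₂ i j * r D₂ i = a at h2'
    rw [hr', hD] at h2'
    simp only [Pi.add_apply, Pi.smul_apply, smul_eq_mul, hv, add_mul, Finset.sum_add_distrib,
      mul_ite, mul_one, mul_zero, ite_mul, zero_mul, Finset.sum_ite_eq', Finset.mem_univ,
      if_true] at h2'
    have : ((1 : ℝ) / (k₁ + 1) - 1 / (k₂ + 1)) * r D₁ l = 0 := by linarith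
    exact (mul_ne_zero (sub_ne_zero.2 hne) h1) this
  · refine MeasurableSet.inter ?_ ?_
    · exact (measurableSet_singleton (0 : ℝ)).compl.preimage (hrm l)
    · refine measurableSet_eq_fun (Finset.measurable_sum _ fun i _ => ?_) measurable_const
      exact (Continuous.measurable (by fun_prop : Continuous fun D : Dict m n => D i j)).mul (hrm i)

/-- On `S` the optimality conditions read `Dᵀ D z = Dᵀ y - lam s`; off `S` the added diagonal forces
`z = 0`. Independence of the columns in `S` makes this system invertible, so it recovers `z`. -/
lemma maskedResidual_eq
    (hinj : ∀ c : Fin n → ℝ, (∀ j, z j = 0 → c j = 0) → Matrix.of D *ᵥ c = 0 → c = 0)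
    {S : Finset (Fin n)} (hS : ∀ j, j ∈ S ↔ z j ≠ 0) {s : Fin n → ℝ}
    (hs : ∀ j ∈ S, corr y D z j = lam * s j) (hs0 : ∀ j ∉ S, s j = 0) :
    maskedResidual y lam S s (maskDict S D) = y - Matrix.of D *ᵥ z := by
  set M := maskDict S D with hM
  have hMc : ∀ c : Fin n → ℝ, (∀ j ∉ S, c j = 0) → Matrix.of M *ᵥ c = Matrix.of D *ᵥ c := by
    intro c hc
    funext l
    simp only [Matrix.mulVec, dotProduct]
    refine Finset.sum_congr rfl fun k _ => ?_
    by_cases hk : k ∈ S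
    · simp [hM, maskDict, hk]
    · simp [hc k hk]
  have hMr : ∀ (r : Fin m → ℝ) k, ((Matrix.of M)ᵀ *ᵥ r) k
      = if k ∈ S then ((Matrix.of D)ᵀ *ᵥ r) k else 0 := by
    intro r k
    by_cases hk : k ∈ S <;> simp [hM, maskDict, hk, Matrix.mulVec, dotProduct]
  have hG : ∀ (c : Fin n → ℝ) k, (maskedGram S M *ᵥ c) k
      = ((Matrix.of M)ᵀ *ᵥ (Matrix.of M *ᵥ c)) k + if k ∈ S then 0 else c k := by
    intro c k
    rw [maskedGram, Matrix.add_mulVec, Matrix.mulVec_mulVec, Pi.add_apply, Matrix.mulVec_diagonal]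
    simp
  have hz0 : ∀ j ∉ S, z j = 0 := fun j hj => by
    by_contra h
    exact hj ((hS j).2 h)
  have hunit : IsUnit (maskedGram S M) := by
    rw [← Matrix.mulVec_injective_iff_isUnit]
    intro a b hab
    suffices h : a - b = 0 from sub_eq_zero.1 h
    set c := a - b with hcab
    have hc : maskedGram S M *ᵥ c = 0 := by rw [hcab, Matrix.mulVec_sub]; exact sub_eq_zero.2 hab
    have hc' : ∀ k, (maskedGram S M *ᵥ c) k = 0 := fun k => congrFun hc k
    have hc0 : ∀ k ∉ S, c k = 0 := fun k hk => by
      have := hc' k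
      rw [hG, hMr] at this
      simpa [hk] using this
    refine hinj c (fun j hj => hc0 j fun h => (hS j).1 h hj) ?_
    rw [← hMc c hc0]
    have h0 : (Matrix.of M)ᵀ *ᵥ (Matrix.of M *ᵥ c) = 0 := by
      funext k
      have h1 := hc' k
      rw [hG] at h1
      by_cases hk : k ∈ S
      · simpa [hk] using h1
      · simp [hMr, hk]
    have h1 := transpose_mulVec_dotProduct M (Matrix.of M *ᵥ c) c
    rw [h0, zero_dotProduct] at h1
    exact dotProduct_self_eq_zero.1 h1.symm
  have hGz : maskedGram S M *ᵥ z = (Matrix.of M)ᵀ *ᵥ y - lam • s := by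
    funext k
    rw [hG, hMr, hMc z hz0, Pi.sub_apply, hMr]
    by_cases hk : k ∈ S
    · have := hs k hk
      rw [corr, Matrix.mulVec_sub, Pi.sub_apply] at this
      simp only [hk, if_true, Pi.smul_apply, smul_eq_mul]
      linarith
    · simp [hk, hz0 k hk, hs0 k hk]
  have hdet := (Matrix.isUnit_iff_isUnit_det _).1 hunit
  rw [maskedResidual, ← hGz, Matrix.mulVec_mulVec z, Matrix.nonsing_inv_mul _ hdet,
    Matrix.one_mulVec, hMc z hz0]

/-- For almost every dictionary, the Lasso solution is nondegenerate. -/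
theorem ae_nondegenerate (y : Fin m → ℝ) (hlam : 0 < lam) :
    ∀ᵐ D : Dict m n, ∀ z, IsLassoSol y lam D z → Nondegenerate y lam D z := by
  have hnull : ∀ᵐ D : Dict m n, ∀ (S : Finset (Fin n)) (σ : Fin n → SignType) (a : SignType)
      (j : Fin n) (l : Fin m), j ∉ S →
      ¬ (maskedResidual y lam S (fun k => (σ k : ℝ)) (maskDict S D) l ≠ 0 ∧
        ∑ i, D i j * maskedResidual y lam S (fun k => (σ k : ℝ)) (maskDict S D) i
          = lam * (a : ℝ)) := by
    refine ae_all_iff.2 fun S => ae_all_iff.2 fun σ => ae_all_iff.2 fun a => ae_all_iff.2 fun j =>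
      ae_all_iff.2 fun l => ?_
    by_cases hj : j ∈ S
    · exact Eventually.of_forall fun D h => absurd hj h
    · filter_upwards [measure_eq_zero_iff_ae_notMem.1 (volume_maskedResidual_orthogonal y lam S
        (fun k => (σ k : ℝ)) (lam * (a : ℝ)) hj l)] with D hD _ using hD
  filter_upwards [hnull] with D hD z hz
  obtain ⟨w, hw, hinj⟩ := hz.exists_injective_support hlam.le
  -- A nondegenerate solution is the only one, so the given `z` equals the solution `w` with
  -- independent support columns.
  suffices h : Nondegenerate y lam D w by rwa [h.eq hlam hw hz]
  refine ⟨hinj, fun j hj => lt_of_le_of_ne (hw.abs_corr_le hlam.le j) fun hEq => ?_⟩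
  have hsign : ∀ k, |corr y D w k| = lam →
      corr y D w k = lam * ((SignType.sign (corr y D w k) : SignType) : ℝ) := by
    intro k hk
    nth_rewrite 1 [← sign_mul_abs (corr y D w k)]
    rw [hk, mul_comm]
  have hS : ∀ k, k ∈ Finset.univ.filter (fun k => w k ≠ 0) ↔ w k ≠ 0 := by simp
  have hres := maskedResidual_eq hinj hS
    (s := fun k => ((if w k = 0 then 0 else SignType.sign (corr y D w k) : SignType) : ℝ))
    (fun k hk => by
      have hk' := (hS k).1 hk
      simp only [if_neg hk']
      exact hsign k (hw.abs_corr_eq hlam.le hk'))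
    (fun k hk => by
      have hk' : w k = 0 := by simpa using hk
      simp [hk'])
  have hcj : corr y D w j = ∑ i, D i j * (y - Matrix.of D *ᵥ w) i := rfl
  -- A zero residual would make every correlation vanish, against `|corr y D w j| = lam > 0`.
  have hl : ∃ l, (y - Matrix.of D *ᵥ w) l ≠ 0 := by
    by_contra! h0
    rw [hcj] at hEq
    simp only [h0, mul_zero, Finset.sum_const_zero, abs_zero] at hEq
    exact hlam.ne hEq
  obtain ⟨l, hl⟩ := hl
  refine hD (Finset.univ.filter fun k => w k ≠ 0)
    (fun k => if w k = 0 then 0 else SignType.sign (corr y D w k))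
    (SignType.sign (corr y D w j)) j l (by simpa using hj) ⟨?_, ?_⟩
  · rw [hres]
    exact hl
  · rw [hres, ← hcj]
    exact hsign j hEq

end Nondegenerate

/-! ### The Jacobian of the Lasso solution. -/

section LassoJacobian

variable {m n : ℕ} {y : Fin m → ℝ} {lam : ℝ} {D : Dict m n} {z : Fin n → ℝ} {l : Fin m}

lemma sum_support_eq_sum (z : Fin n → ℝ) {f : Fin n → ℝ} (hf : ∀ i, z i = 0 → f i = 0) :
    ∑ i : {i // z i ≠ 0}, f i = ∑ i, f i := by
  refine Fintype.sum_of_injective Subtype.val Subtype.val_injective _ _ (fun i hi => hf i ?_)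
    fun _ => rfl
  by_contra h
  exact hi ⟨⟨i, h⟩, rfl⟩

lemma supportCols_mulVec {c : Fin n → ℝ} (hc : ∀ i, z i = 0 → c i = 0) :
    (supportCols D z *ᵥ fun i => c i) = Matrix.of D *ᵥ c := by
  funext l
  simp only [Matrix.mulVec, dotProduct, supportCols, Matrix.submatrix_apply, id, Matrix.of_apply]
  exact sum_support_eq_sum z (f := fun i => D l i * c i) fun i hi => by simp [hc i hi]

lemma supportGram_mulVec_apply {c : Fin n → ℝ} (hc : ∀ i, z i = 0 → c i = 0)
    (j : {i // z i ≠ 0}) :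
    (supportGram D z *ᵥ fun i => c i) j = ((Matrix.of D)ᵀ *ᵥ (Matrix.of D *ᵥ c)) j := by
  rw [supportGram, ← Matrix.mulVec_mulVec, supportCols_mulVec hc]
  rfl

/-- The Gram matrix of the support columns is invertible exactly when these are independent. -/
theorem isUnit_supportGram_iff : IsUnit (supportGram D z) ↔
    ∀ c : Fin n → ℝ, (∀ j, z j = 0 → c j = 0) → Matrix.of D *ᵥ c = 0 → c = 0 := by
  classical
  rw [← Matrix.mulVec_injective_iff_isUnit]
  constructor
  · intro hinj c hc hD
    have h1 : supportGram D z *ᵥ (fun i : {i // z i ≠ 0} => c i) = supportGram D z *ᵥ 0 := by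
      funext j
      rw [supportGram_mulVec_apply hc, hD, Matrix.mulVec_zero, Matrix.mulVec_zero]
      rfl
    funext i
    by_cases hi : z i = 0
    · exact hc i hi
    · exact congrFun (hinj h1) ⟨i, hi⟩
  · intro h a b hab
    suffices h0 : a - b = 0 from sub_eq_zero.1 h0
    have hG : supportGram D z *ᵥ (a - b) = 0 := by
      rw [Matrix.mulVec_sub]; exact sub_eq_zero.2 hab
    set c : Fin n → ℝ := fun i => if hi : z i ≠ 0 then (a - b) ⟨i, hi⟩ else 0 with hcdef
    have hc0 : ∀ j, z j = 0 → c j = 0 := fun j hj => by simp [hcdef, hj]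
    have hca : (fun i : {i // z i ≠ 0} => c i) = a - b := by
      funext i
      simp only [hcdef]
      rw [dif_pos i.2]
    have hDc : Matrix.of D *ᵥ c = 0 := by
      have h1 := transpose_mulVec_dotProduct D (Matrix.of D *ᵥ c) c
      have h2 : ((Matrix.of D)ᵀ *ᵥ (Matrix.of D *ᵥ c)) ⬝ᵥ c = 0 := by
        refine Finset.sum_eq_zero fun j _ => ?_
        by_cases hj : z j = 0
        · rw [hc0 j hj, mul_zero]
        · have := supportGram_mulVec_apply (D := D) hc0 ⟨j, hj⟩
          rw [hca, hG] at this
          rw [← this]; simp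
      rw [h2] at h1
      exact dotProduct_self_eq_zero.1 h1.symm
    rw [← hca, h c hc0 hDc]
    rfl

lemma lassoJac_eq_zero {i : Fin n} (hi : z i = 0) (k : Fin n) : lassoJac y D l z i k = 0 := by
  simp [lassoJac, hi]

lemma gram_mul_lassoJac (h : IsUnit (supportGram D z)) {j : Fin n} (hj : z j ≠ 0) (k : Fin n) :
    ((Matrix.of D)ᵀ * Matrix.of D * lassoJac y D l z) j k = - rowTerm y D l z j k := by
  classical
  have h1 : ((Matrix.of D)ᵀ * Matrix.of D * lassoJac y D l z) j k
      = ((Matrix.of D)ᵀ *ᵥ (Matrix.of D *ᵥ fun i => lassoJac y D l z i k)) j := by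
    rw [Matrix.mulVec_mulVec]; rfl
  rw [h1, ← supportGram_mulVec_apply (D := D) (z := z) (c := fun i => lassoJac y D l z i k)
    (fun i hi => lassoJac_eq_zero hi k) ⟨j, hj⟩]
  have h2 : (fun i : {i // z i ≠ 0} => lassoJac y D l z i k)
      = fun i => (-((supportGram D z)⁻¹ * (rowTerm y D l z).submatrix Subtype.val id :
        Matrix {i : Fin n // z i ≠ 0} (Fin n) ℝ)) i k := by
    funext i
    simp only [lassoJac, Matrix.of_apply]
    rw [dif_pos i.2]
    rfl
  have key : ∀ R : Matrix {i : Fin n // z i ≠ 0} (Fin n) ℝ,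
      supportGram D z * (-((supportGram D z)⁻¹ * R)) = -R := fun R => by
    rw [Matrix.mul_neg, ← Matrix.mul_assoc,
      Matrix.mul_nonsing_inv _ ((Matrix.isUnit_iff_isUnit_det _).1 h), Matrix.one_mul]
  rw [h2]
  exact congrFun (congrFun (key ((rowTerm y D l z).submatrix Subtype.val id)) ⟨j, hj⟩) k

/-- The difference `c` of the two columns is supported in the support of `z`, and `Dᵀ D c` vanishes
there; hence `‖D c‖² = 0` and independence gives `c = 0`. -/
lemma eq_lassoJac (h : IsUnit (supportGram D z)) {J : Matrix (Fin n) (Fin n) ℝ} {k : Fin n}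
    (h0 : ∀ i, z i = 0 → J i k = 0)
    (hJ : ∀ j, z j ≠ 0 → ((Matrix.of D)ᵀ * Matrix.of D * J) j k = - rowTerm y D l z j k)
    (i : Fin n) : J i k = lassoJac y D l z i k := by
  set c : Fin n → ℝ := fun i => J i k - lassoJac y D l z i k with hc
  have hc0 : ∀ j, z j = 0 → c j = 0 := fun j hj => by
    simp [hc, h0 j hj, lassoJac_eq_zero hj]
  have hcol : (Matrix.of D)ᵀ *ᵥ (Matrix.of D *ᵥ c) = fun j =>
      ((Matrix.of D)ᵀ * Matrix.of D * J) j k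
        - ((Matrix.of D)ᵀ * Matrix.of D * lassoJac y D l z) j k := by
    have : c = (fun i => J i k) - fun i => lassoJac y D l z i k := rfl
    rw [this, Matrix.mulVec_mulVec, Matrix.mulVec_sub]
    rfl
  have hDc : Matrix.of D *ᵥ c = 0 := by
    have h1 := transpose_mulVec_dotProduct D (Matrix.of D *ᵥ c) c
    have h2 : ((Matrix.of D)ᵀ *ᵥ (Matrix.of D *ᵥ c)) ⬝ᵥ c = 0 := by
      refine Finset.sum_eq_zero fun j _ => ?_
      by_cases hj : z j = 0
      · rw [hc0 j hj, mul_zero]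
      · rw [hcol]
        simp only
        rw [hJ j hj, gram_mul_lassoJac h hj, sub_self, zero_mul]
    rw [h2] at h1
    exact dotProduct_self_eq_zero.1 h1.symm
  have := congrFun (isUnit_supportGram_iff.1 h c hc0 hDc) i
  exact sub_eq_zero.1 this

variable {zs : Dict m n → Fin n → ℝ}

/-- At a nondegenerate dictionary, the derivative of the Lasso solution is `lassoJac`. -/
lemma Nondegenerate.fderiv_eq (hlam : 0 < lam) (hzs : ∀ D, IsLassoSol y lam D (zs D))
    (h : Nondegenerate y lam D (zs D)) (hd : ∀ i, DifferentiableAt ℝ (fun D => zs D i) D)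
    (l : Fin m) (i k : Fin n) :
    fderiv ℝ (fun D => zs D i) D (Pi.single l (Pi.single k 1)) = lassoJac y D l (zs D) i k := by
  refine eq_lassoJac (J := Matrix.of fun i k =>
    fderiv ℝ (fun D => zs D i) D (Pi.single l (Pi.single k 1)))
    (isUnit_supportGram_iff.2 h.1) (fun j hj => ?_) (fun j hj => ?_) i
  · have hev : (fun D => zs D j) =ᶠ[𝓝 D] fun _ => 0 := by
      filter_upwards [(hzs D).eventually_norm_corr_sub_lt hlam (sub_pos.2 (h.2 j hj))] with D' hD'
      refine (hzs D').eq_zero_of_abs_corr_lt hlam.le ?_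
      have h1 := (norm_le_pi_norm (corr y D' (zs D') - corr y D (zs D)) j).trans_lt (hD' _ (hzs D'))
      have h2 := abs_sub_abs_le_abs_sub (corr y D' (zs D') j) (corr y D (zs D) j)
      rw [Pi.sub_apply, Real.norm_eq_abs] at h1
      linarith
    simp [hev.fderiv_eq]
  -- Near `D` the coordinate stays nonzero, so the correlation is `lam` or `-lam`; a jump between
  -- these has size `2 * lam`, which continuity excludes.
  · have hev : (fun D => corr y D (zs D) j) =ᶠ[𝓝 D] fun _ => corr y D (zs D) j := by
      filter_upwards [(hzs D).eventually_norm_corr_sub_lt hlam hlam,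
        (hd j).continuousAt.eventually_ne hj] with D' hD' hne
      have h1 := (norm_le_pi_norm (corr y D' (zs D') - corr y D (zs D)) j).trans_lt (hD' _ (hzs D'))
      rw [Pi.sub_apply, Real.norm_eq_abs, abs_lt] at h1
      rcases (abs_eq hlam.le).1 ((hzs D').abs_corr_eq hlam.le hne) with ha | ha <;>
        rcases (abs_eq hlam.le).1 ((hzs D).abs_corr_eq hlam.le hj) with hb | hb <;>
        linarith [h1.1, h1.2]
    have h1 := (hasFDerivAt_corr_comp y (u := zs) (l := l) (J := Matrix.of fun i k =>
      fderiv ℝ (fun D => zs D i) D (Pi.single l (Pi.single k 1))) k hd (fun i => rfl) j).2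
    rw [hev.fderiv_eq] at h1
    simp only [fderiv_fun_const, Pi.zero_apply, zero_apply, Matrix.add_apply] at h1
    linarith

lemma uniqueDomain_locallyLipschitzOn (hlam : 0 < lam) (hzs : ∀ D, IsLassoSol y lam D (zs D))
    (i : Fin n) : LocallyLipschitzOn (uniqueDomain n y lam) fun D => zs D i := by
  intro D hD
  obtain ⟨K, t, ht, hK⟩ :=
    (equiInjective_of_mem_uniqueDomain hlam (hzs D) hD).exists_lipschitzOnWith
    hlam hzs
  refine ⟨K, t, mem_nhdsWithin_of_mem_nhds ht, ?_⟩
  have := (LipschitzWith.eval (α := fun _ : Fin n => ℝ) i).comp_lipschitzOnWith hK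
  rwa [one_mul] at this

theorem isWeakJacobianOn_lassoSol (hlam : 0 < lam) (hzs : ∀ D, IsLassoSol y lam D (zs D))
    (l : Fin m) :
    IsWeakJacobianOn (uniqueDomain n y lam) zs l fun D => lassoJac y D l (zs D) := by
  have hlip := uniqueDomain_locallyLipschitzOn hlam hzs
  refine isWeakJacobianOn_of_locallyLipschitzOn isOpen_interior hlip ?_
  filter_upwards [ae_nondegenerate y hlam, ae_all_iff.2 fun i =>
    (hlip i).ae_differentiableAt (μ := volume) isOpen_interior] with D hD hd hDU i k
  rw [(hd i hDU).lineDeriv_eq_fderiv]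
  exact (hD _ (hzs D)).fderiv_eq hlam hzs (fun i => hd i hDU) l i k

end LassoJacobian

/-! ### Convergence of ISTA and of the propagated Jacobians. -/

section Convergence

variable {m n : ℕ} {y : Fin m → ℝ} {lam L : ℝ} {D : Dict m n} {z : Fin n → ℝ}

lemma sum_sq_mulVec_le (hL : specNorm D ^ 2 ≤ L) (x : Fin n → ℝ) :
    ∑ l, ((Matrix.of D *ᵥ x) l) ^ 2 ≤ L * ∑ i, x i ^ 2 := by
  have h := (LinearMap.toContinuousLinearMap (Matrix.toLpLin 2 2 (Matrix.of D))).le_opNorm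
    (WithLp.toLp 2 x)
  have h2 := pow_le_pow_left₀ (norm_nonneg _) h 2
  rw [mul_pow, EuclideanSpace.norm_sq_eq, EuclideanSpace.norm_sq_eq] at h2
  simp only [Real.norm_eq_abs, sq_abs] at h2
  refine le_trans h2 ?_
  gcongr
  exact hL

lemma sum_sq_transpose_mulVec_le (hL : specNorm D ^ 2 ≤ L) (r : Fin m → ℝ) :
    ∑ i, (((Matrix.of D)ᵀ *ᵥ r) i) ^ 2 ≤ L * ∑ l, r l ^ 2 := by
  set w := (Matrix.of D)ᵀ *ᵥ r with hw
  have h1 : ∑ i, w i ^ 2 = r ⬝ᵥ (Matrix.of D *ᵥ w) := by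
    rw [← transpose_mulVec_dotProduct, ← hw, dotProduct_self_eq_sum_sq]
  have h2 : (r ⬝ᵥ (Matrix.of D *ᵥ w)) ^ 2
      ≤ (∑ l, r l ^ 2) * ∑ l, ((Matrix.of D *ᵥ w) l) ^ 2 := Finset.sum_mul_sq_le_sq_mul_sq _ _ _
  have h3 := sum_sq_mulVec_le hL w
  have hr : 0 ≤ ∑ l, r l ^ 2 := by positivity
  have hw0 : 0 ≤ ∑ i, w i ^ 2 := by positivity
  rw [← h1] at h2
  rcases hw0.eq_or_lt with h0 | h0
  · rw [← h0]
    exact mul_nonneg ((sq_nonneg _).trans hL) hr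
  · refine le_of_mul_le_mul_right ?_ h0
    calc (∑ i, w i ^ 2) * ∑ i, w i ^ 2 = (∑ i, w i ^ 2) ^ 2 := (sq _).symm
      _ ≤ (∑ l, r l ^ 2) * ∑ l, ((Matrix.of D *ᵥ w) l) ^ 2 := h2
      _ ≤ (∑ l, r l ^ 2) * (L * ∑ i, w i ^ 2) := by gcongr
      _ = _ := by ring

/-- The optimality conditions of the soft-thresholding. -/
lemma softThreshold_optimality {μ : ℝ} (hμ : 0 ≤ μ) (v : ℝ) :
    |v - softThreshold μ v| ≤ μ ∧
      (v - softThreshold μ v) * softThreshold μ v = μ * |softThreshold μ v| := by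
  rcases le_or_gt |v| μ with h | h
  · rw [softThreshold_of_abs_le h]
    simpa using h
  · rw [softThreshold_eq_sub hμ]
    rcases lt_abs.1 h with hv | hv
    · rw [max_eq_left (by linarith), max_eq_right (by linarith), sub_zero, sub_sub_cancel,
        abs_of_nonneg hμ, abs_of_pos (by linarith : 0 < v - μ)]
      simp
    · rw [max_eq_right (by linarith), max_eq_left (by linarith), zero_sub]
      have e : v - -(-v - μ) = -μ := by ring
      rw [e, abs_neg, abs_neg, abs_of_nonneg hμ, abs_of_pos (by linarith : 0 < -v - μ)]
      exact ⟨le_rfl, by ring⟩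

/-- The thresholded point minimises an `L`-strongly convex function of one variable, and the last
square on the left is the gain from strong convexity. -/
lemma softThreshold_prox_le (hlam : 0 < lam) (hL : 0 < L) (u c w : ℝ) :
    lam * |softThreshold (lam / L) (u + (1 / L) * c)|
        + L / 2 * (softThreshold (lam / L) (u + (1 / L) * c) - u) ^ 2
        - c * (softThreshold (lam / L) (u + (1 / L) * c) - u)
        + L / 2 * (w - softThreshold (lam / L) (u + (1 / L) * c)) ^ 2
      ≤ lam * |w| + L / 2 * (w - u) ^ 2 - c * (w - u) := by
  obtain ⟨h1, h2⟩ := softThreshold_optimality (by positivity : 0 ≤ lam / L) (u + (1 / L) * c)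
  set p := softThreshold (lam / L) (u + (1 / L) * c) with hp
  set s := u + (1 / L) * c - p with hs
  have h3 := mul_abs_sub_mul_nonneg h1 w
  have h4 : 0 ≤ L * (lam / L * |w| - s * w - (lam / L * |p| - s * p)) :=
    mul_nonneg hL.le (by linarith)
  have h5 : L * (lam / L * |w| - s * w - (lam / L * |p| - s * p))
      = lam * |w| - lam * |p| - (L * s) * (w - p) := by field_simp; ring
  have h6 : L * s = L * (u - p) + c := by rw [hs]; field_simp; ring
  rw [h5, h6] at h4
  nlinarith

/-- The basic inequality of the proximal gradient method. -/
lemma ista_descent (hlam : 0 < lam) (hL : 0 < L) (hspec : specNorm D ^ 2 ≤ L) (N : ℕ)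
    (w : Fin n → ℝ) :
    lassoObj y lam (ista y lam L (N + 1) D) D - lassoObj y lam w D
      ≤ L / 2 * ∑ i, (w i - ista y lam L N D i) ^ 2
        - L / 2 * ∑ i, (w i - ista y lam L (N + 1) D i) ^ 2 := by
  set u := ista y lam L N D with hu
  set p := ista y lam L (N + 1) D with hp
  have h1 := lassoObj_sub_lassoObj y lam D u p
  have h2 := lassoObj_sub_lassoObj y lam D u w
  -- The condition `‖D‖² ≤ L` enters here: the quadratic term at `p` is dominated by that of the
  -- proximal model, while the one at `w` is dropped by nonnegativity.
  have h3 := sum_sq_mulVec_le hspec (p - u)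
  have h4 : 0 ≤ ∑ l, ((Matrix.of D *ᵥ (w - u)) l) ^ 2 := by positivity
  have h5 : ∑ i, (lam * |p i| + L / 2 * (p i - u i) ^ 2 - corr y D u i * (p i - u i)
        + L / 2 * (w i - p i) ^ 2)
      ≤ ∑ i, (lam * |w i| + L / 2 * (w i - u i) ^ 2 - corr y D u i * (w i - u i)) := by
    refine Finset.sum_le_sum fun i _ => ?_
    rw [hp, ista_succ_apply, ← hu]
    exact softThreshold_prox_le hlam hL (u i) (corr y D u i) (w i)
  simp only [Finset.sum_add_distrib, Finset.sum_sub_distrib, mul_sub, ← Finset.mul_sum,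
    Pi.sub_apply] at h1 h2 h3 h5
  nlinarith

/-- Each gap is at most a decrement of the scaled squared distance to `z`, a nonincreasing sequence
bounded below, so the decrements tend to zero. -/
lemma tendsto_lassoObj_ista (hlam : 0 < lam) (hL : 0 < L) (hspec : specNorm D ^ 2 ≤ L)
    (hz : IsLassoSol y lam D z) :
    Tendsto (fun N => lassoObj y lam (ista y lam L N D) D - lassoObj y lam z D) atTop (𝓝 0) := by
  set a : ℕ → ℝ := fun N => L / 2 * ∑ i, (z i - ista y lam L N D i) ^ 2 with ha
  have hstep : ∀ N, lassoObj y lam (ista y lam L (N + 1) D) D - lassoObj y lam z D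
      ≤ a N - a (N + 1) := fun N => ista_descent hlam hL hspec N z
  have hnn : ∀ w, 0 ≤ lassoObj y lam w D - lassoObj y lam z D := fun w => sub_nonneg.2 (hz w)
  have hanti : Antitone a := antitone_nat_of_succ_le fun N => by
    linarith [hstep N, hnn (ista y lam L (N + 1) D)]
  have hbdd : BddBelow (Set.range a) := ⟨0, by rintro _ ⟨N, rfl⟩; simp only [ha]; positivity⟩
  have hlim := tendsto_atTop_ciInf hanti hbdd
  have hdiff : Tendsto (fun N => a N - a (N + 1)) atTop (𝓝 0) := by
    simpa using hlim.sub (hlim.comp (tendsto_add_atTop_nat 1))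
  rw [← tendsto_add_atTop_iff_nat 1]
  exact squeeze_zero (fun N => hnn _) hstep hdiff

lemma Nondegenerate.exists_le_norm (h : Nondegenerate y lam D z) :
    ∃ μ : ℝ, 0 < μ ∧ ∀ c : Fin n → ℝ, (∀ j, z j = 0 → c j = 0) → μ * ‖c‖ ≤ ‖Matrix.of D *ᵥ c‖ := by
  obtain ⟨μ, hμ, hev⟩ := eventually_le_norm_mulVec h.1
  exact ⟨μ, hμ, hev.self_of_nhds⟩

/-- ISTA converges to a nondegenerate Lasso solution. -/
theorem tendsto_ista (hlam : 0 < lam) (hL : 0 < L) (hspec : specNorm D ^ 2 ≤ L)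
    (hz : IsLassoSol y lam D z) (h : Nondegenerate y lam D z) :
    Tendsto (fun N => ista y lam L N D) atTop (𝓝 z) := by
  set u : ℕ → Fin n → ℝ := fun N => ista y lam L N D with hu
  have hgap := tendsto_lassoObj_ista hlam hL hspec hz
  have hterm : ∀ N j, 0 ≤ lam * |u N j| - corr y D z j * u N j := fun N j =>
    mul_abs_sub_mul_nonneg (hz.abs_corr_le hlam.le j) _
  have hsq : ∀ N, 0 ≤ ∑ l, ((Matrix.of D *ᵥ (u N - z)) l) ^ 2 := fun N => by positivity
  have hfit : Tendsto (fun N => Matrix.of D *ᵥ (u N - z)) atTop (𝓝 0) := by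
    refine squeeze_zero_norm (a := fun N => Real.sqrt (2 *
      (lassoObj y lam (ista y lam L N D) D - lassoObj y lam z D))) (fun N => ?_) ?_
    · refine Real.le_sqrt_of_sq_le ((sq_norm_le_sum_sq _).trans ?_)
      rw [hz.gap hlam.le]
      have := Finset.sum_nonneg fun j (_ : j ∈ Finset.univ) => hterm N j
      linarith
    · have := (hgap.const_mul 2).sqrt
      simpa using this
  -- Off the support, strict complementarity makes the gap dominate `(lam - |corr y D z j|) * |u N
  -- j|`.
  have hoff : ∀ j, z j = 0 → Tendsto (fun N => u N j) atTop (𝓝 0) := by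
    intro j hj
    have hpos : 0 < lam - |corr y D z j| := sub_pos.2 (h.2 j hj)
    refine squeeze_zero_norm (a := fun N => (lam - |corr y D z j|)⁻¹ *
      (lassoObj y lam (ista y lam L N D) D - lassoObj y lam z D)) (fun N => ?_) ?_
    · rw [le_inv_mul_iff₀ hpos, hz.gap hlam.le, Real.norm_eq_abs]
      have h1 := Finset.single_le_sum (f := fun j => lam * |u N j| - corr y D z j * u N j)
        (fun j _ => hterm N j) (Finset.mem_univ j)
      have h2 : corr y D z j * u N j ≤ |corr y D z j| * |u N j| := by
        rw [← abs_mul]; exact le_abs_self _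
      have h3 := hsq N
      simp only [hu] at h1 h2 h3 ⊢
      linarith
    · simpa using hgap.const_mul (lam - |corr y D z j|)⁻¹
  classical
  obtain ⟨μ, hμ, hle⟩ := h.exists_le_norm
  -- Once the part off the support is removed, the error lies where `D` is bounded below, so
  -- convergence of the fit gives convergence of the error.
  let off : ℕ → Fin n → ℝ := fun N j => if z j = 0 then u N j else 0
  have hofflim : Tendsto off atTop (𝓝 0) := by
    refine tendsto_pi_nhds.2 fun j => ?_
    by_cases hj : z j = 0
    · simpa [off, hj] using hoff j hj
    · simp [off, hj]
  have hDoff : Tendsto (fun N => Matrix.of D *ᵥ off N) atTop (𝓝 0) := by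
    have hc : Continuous fun x : Fin n → ℝ => Matrix.of D *ᵥ x :=
      Continuous.matrix_mulVec continuous_const continuous_id
    simpa [Function.comp_def] using (hc.tendsto 0).comp hofflim
  have hon : Tendsto (fun N => u N - z - off N) atTop (𝓝 0) := by
    refine squeeze_zero_norm (a := fun N => μ⁻¹ * ‖Matrix.of D *ᵥ (u N - z) - Matrix.of D *ᵥ off N‖)
      (fun N => ?_) ?_
    · rw [le_inv_mul_iff₀ hμ, ← Matrix.mulVec_sub]
      exact hle _ fun j hj => by simp [off, hj]
    · simpa using ((hfit.sub hDoff).norm).const_mul μ⁻¹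
  have := (hon.add hofflim).add_const z
  simpa using this

lemma eventually_atTop_of_succ {p : ℕ → Prop} (h : ∀ᶠ N in atTop, p (N + 1)) :
    ∀ᶠ N in atTop, p N := by
  obtain ⟨a, ha⟩ := eventually_atTop.1 h
  refine eventually_atTop.2 ⟨a + 1, fun N hN => ?_⟩
  have := ha (N - 1) (by omega)
  rwa [Nat.sub_add_cancel (by omega)] at this

/-- ISTA identifies the support of a nondegenerate solution in finitely many steps. -/
theorem eventually_ista_support (hlam : 0 < lam) (hL : 0 < L) (hspec : specNorm D ^ 2 ≤ L)
    (hz : IsLassoSol y lam D z) (h : Nondegenerate y lam D z) :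
    ∀ᶠ N in atTop, ∀ i, ista y lam L N D i = 0 ↔ z i = 0 := by
  have hlim := tendsto_ista hlam hL hspec hz h
  refine eventually_all.2 fun i => ?_
  have hi : Tendsto (fun N => ista y lam L N D i) atTop (𝓝 (z i)) := tendsto_pi_nhds.1 hlim i
  by_cases hzi : z i = 0
  · have hcorr : Continuous fun w : Fin n → ℝ => corr y D w i := by
      have := (contDiff_corr (n := n) y).continuous
      exact (continuous_apply i).comp (this.comp (Continuous.prodMk_right D))
    have hv : Tendsto (fun N => |ista y lam L N D i + (1 / L) * corr y D (ista y lam L N D) i|)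
        atTop (𝓝 |z i + (1 / L) * corr y D z i|) :=
      (hi.add (((hcorr.tendsto z).comp hlim).const_mul _)).abs
    -- Strict complementarity places the limit of the thresholding input strictly inside the
    -- interval sent to zero. The conclusion then concerns the iterate `N + 1`, hence the shift of
    -- index.
    have hlt : |z i + (1 / L) * corr y D z i| < lam / L := by
      rw [hzi, zero_add, abs_mul, abs_of_pos (by positivity : (0 : ℝ) < 1 / L), one_div_mul_eq_div]
      gcongr
      exact h.2 i hzi
    have hev := hv.eventually (gt_mem_nhds hlt)
    refine eventually_atTop_of_succ ?_
    filter_upwards [hev] with N hN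
    rw [ista_succ_apply, softThreshold_of_abs_le hN.le]
    simp [hzi]
  · filter_upwards [hi.eventually_ne hzi] with N hN
    simp [hN, hzi]

lemma tendsto_zero_of_le_mul_add {a d : ℕ → ℝ} {q : ℝ} (hq0 : 0 ≤ q) (hq : q < 1)
    (ha : ∀ N, 0 ≤ a N) (hd : Tendsto d atTop (𝓝 0))
    (h : ∀ᶠ N in atTop, a (N + 1) ≤ q * a N + d N) : Tendsto a atTop (𝓝 0) := by
  refine (tendsto_order.2 ⟨fun b hb => Eventually.of_forall fun N => hb.trans_le (ha N),
    fun b hb => ?_⟩)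
  -- Once `d N < (1 - q) ε`, the recursion contracts `a N - ε` from above by the factor `q`.
  set ε := b / 2 with hε
  have hε0 : 0 < ε := by positivity
  obtain ⟨N₀, hN₀⟩ := eventually_atTop.1
    (h.and (hd.eventually (gt_mem_nhds (mul_pos (sub_pos.2 hq) hε0))))
  have hgeom : ∀ k, a (N₀ + k) - ε ≤ q ^ k * |a N₀ - ε| := by
    intro k
    induction k with
    | zero => simpa using le_abs_self (a N₀ - ε)
    | succ k ih =>
      obtain ⟨h1, h2⟩ := hN₀ (N₀ + k) (Nat.le_add_right _ _)
      have h3 := mul_le_mul_of_nonneg_left ih hq0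
      rw [← add_assoc, pow_succ']
      linarith
  have hpow : Tendsto (fun k => q ^ k * |a N₀ - ε|) atTop (𝓝 0) := by
    simpa using (tendsto_pow_atTop_nhds_zero_of_lt_one hq0 hq).mul_const |a N₀ - ε|
  have hev : ∀ᶠ k in atTop, a (k + N₀) < b := by
    filter_upwards [hpow.eventually (gt_mem_nhds hε0)] with k hk
    rw [add_comm]
    linarith [hgeom k]
  obtain ⟨k₀, hk₀⟩ := eventually_atTop.1 hev
  refine eventually_atTop.2 ⟨k₀ + N₀, fun N hN => ?_⟩
  have := hk₀ (N - N₀) (by omega)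
  rwa [Nat.sub_add_cancel (by omega)] at this

/-- The gradient step contracts the vectors supported in the support of the solution. -/
lemma Nondegenerate.exists_contraction (hL : 0 < L) (hspec : specNorm D ^ 2 ≤ L)
    (h : Nondegenerate y lam D z) :
    ∃ q : ℝ, 0 ≤ q ∧ q < 1 ∧ ∀ c : Fin n → ℝ, (∀ j, z j = 0 → c j = 0) →
      Real.sqrt (∑ i, (c i - (1 / L) * ((Matrix.of D)ᵀ *ᵥ (Matrix.of D *ᵥ c)) i) ^ 2)
        ≤ q * Real.sqrt (∑ i, c i ^ 2) := by
  obtain ⟨μ, hμ, hle⟩ := h.exists_le_norm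
  -- With `s = ‖D c‖²`, expanding the square and using `‖Dᵀ D c‖² ≤ L s` leaves at most `‖c‖² - s /
  -- L ≤ (1 - κ) ‖c‖²`. The factor `n + 1` compares Euclidean and sup norms and stays positive when
  -- `n = 0`.
  set κ : ℝ := μ ^ 2 / ((n + 1) * L) with hκ
  have hκ0 : 0 < κ := by positivity
  refine ⟨Real.sqrt (1 - κ), Real.sqrt_nonneg _, ?_, fun c hc => ?_⟩
  · rw [Real.sqrt_lt' one_pos]; linarith
  have hc2 : ∑ i, c i ^ 2 ≤ (n + 1) * ‖c‖ ^ 2 := by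
    calc ∑ i, c i ^ 2 ≤ ∑ _i : Fin n, ‖c‖ ^ 2 := by
          refine Finset.sum_le_sum fun i _ => ?_
          rw [← sq_abs]
          exact pow_le_pow_left₀ (abs_nonneg _) (norm_le_pi_norm c i) 2
      _ = n * ‖c‖ ^ 2 := by simp
      _ ≤ _ := by gcongr; linarith
  set s := ∑ l, ((Matrix.of D *ᵥ c) l) ^ 2 with hs
  have h1 : μ ^ 2 * ‖c‖ ^ 2 ≤ s := by
    rw [← mul_pow]
    exact (pow_le_pow_left₀ (by positivity) (hle c hc) 2).trans (sq_norm_le_sum_sq _)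
  have h2 : κ * ∑ i, c i ^ 2 ≤ (1 / L) * s := by
    calc κ * ∑ i, c i ^ 2 ≤ κ * ((n + 1) * ‖c‖ ^ 2) := by gcongr
      _ = (1 / L) * (μ ^ 2 * ‖c‖ ^ 2) := by rw [hκ]; field_simp
      _ ≤ _ := by gcongr
  set g := (Matrix.of D)ᵀ *ᵥ (Matrix.of D *ᵥ c) with hg
  have h3 : ∑ i, g i ^ 2 ≤ L * s := sum_sq_transpose_mulVec_le hspec _
  have h4 : ∑ i, g i * c i = s := by
    have := transpose_mulVec_dotProduct D (Matrix.of D *ᵥ c) c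
    rw [dotProduct_self_eq_sum_sq] at this
    exact this
  have h5 : ∑ i, (c i - (1 / L) * g i) ^ 2
      = ∑ i, c i ^ 2 - 2 / L * s + (1 / L) ^ 2 * ∑ i, g i ^ 2 := by
    rw [← h4, Finset.mul_sum, Finset.mul_sum, ← Finset.sum_sub_distrib, ← Finset.sum_add_distrib]
    refine Finset.sum_congr rfl fun i _ => ?_
    ring
  have h6 : (1 / L) ^ 2 * ∑ i, g i ^ 2 ≤ (1 / L) * s := by
    calc (1 / L) ^ 2 * ∑ i, g i ^ 2 ≤ (1 / L) ^ 2 * (L * s) := by gcongr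
      _ = _ := by field_simp
  rw [← Real.sqrt_mul' _ (by positivity)]
  refine Real.sqrt_le_sqrt ?_
  rw [h5]
  have : 2 / L * s = 2 * ((1 / L) * s) := by ring
  linarith

lemma sqrt_sum_sq_add_le (a b : Fin n → ℝ) :
    Real.sqrt (∑ i, (a i + b i) ^ 2) ≤ Real.sqrt (∑ i, a i ^ 2) + Real.sqrt (∑ i, b i ^ 2) := by
  have h := norm_add_le (WithLp.toLp 2 a) (WithLp.toLp 2 b : EuclideanSpace ℝ (Fin n))
  simpa [EuclideanSpace.norm_eq] using h

lemma jacStep_apply (y : Fin m → ℝ) (L : ℝ) (D : Dict m n) (l : Fin m) (u u' : Fin n → ℝ)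
    (J : Matrix (Fin n) (Fin n) ℝ) (i k : Fin n) :
    jacStep y L D l u u' J i k = if u' i = 0 then 0 else
      J i k - (1 / L) * (rowTerm y D l u i k
        + ((Matrix.of D)ᵀ *ᵥ (Matrix.of D *ᵥ fun j => J j k)) i) := by
  have h : ((Matrix.of D)ᵀ * Matrix.of D * J) i k
      = ((Matrix.of D)ᵀ *ᵥ (Matrix.of D *ᵥ fun j => J j k)) i := by
    rw [Matrix.mulVec_mulVec]; rfl
  by_cases hi : u' i = 0
  · simp [jacStep, hi]
  · rw [← h]
    simp [jacStep, hi, mul_add]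

/-- At a nondegenerate solution, the matrices propagated along ISTA converge to `lassoJac`. -/
theorem tendsto_istaJac (hlam : 0 < lam) (hL : 0 < L) (hspec : specNorm D ^ 2 ≤ L)
    (hz : IsLassoSol y lam D z) (h : Nondegenerate y lam D z) (l : Fin m) :
    Tendsto (fun N => istaJac y lam L l N D) atTop (𝓝 (lassoJac y D l z)) := by
  have hlim := tendsto_ista hlam hL hspec hz h
  have hsupp := eventually_ista_support hlam hL hspec hz h
  have hunit := isUnit_supportGram_iff.2 h.1
  refine tendsto_pi_nhds.2 fun i₀ => tendsto_pi_nhds.2 fun k => ?_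
  set e : ℕ → Fin n → ℝ := fun N i => istaJac y lam L l N D i k - lassoJac y D l z i k with he
  -- `δ N` is the error from evaluating the row term at the iterate instead of the limit; it tends
  -- to zero by continuity.
  set δ : ℕ → Fin n → ℝ := fun N i => (1 / L) * (rowTerm y D l z i k
    - rowTerm y D l (ista y lam L N D) i k) with hδ
  have hδlim : Tendsto (fun N => Real.sqrt (∑ i, δ N i ^ 2)) atTop (𝓝 0) := by
    have hc : Continuous fun w : Fin n → ℝ => Real.sqrt (∑ i, ((1 / L) * (rowTerm y D l z i k
        - rowTerm y D l w i k)) ^ 2) := by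
      simp only [rowTerm_apply]
      refine Real.continuous_sqrt.comp (continuous_finsetSum _ fun i _ => ?_)
      split_ifs <;> fun_prop
    simpa [hδ, Function.comp_def] using (hc.tendsto z).comp hlim
  obtain ⟨q, hq0, hq1, hcontr⟩ := h.exists_contraction hL hspec
  have hzero : ∀ᶠ N in atTop, ∀ j, z j = 0 → e N j = 0 := by
    refine eventually_atTop_of_succ ?_
    filter_upwards [(tendsto_add_atTop_nat 1).eventually hsupp] with N hN j hj
    simp only [he, istaJac]
    rw [jacStep_apply, if_pos ((hN j).2 hj), lassoJac_eq_zero hj, sub_zero]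
  -- After identification the mask is that of the solution, for which `lassoJac` is a fixed point of
  -- the recursion; the error thus undergoes a contracted gradient step plus `δ N`.
  have hrec : ∀ᶠ N in atTop, Real.sqrt (∑ i, e (N + 1) i ^ 2)
      ≤ q * Real.sqrt (∑ i, e N i ^ 2) + Real.sqrt (∑ i, δ N i ^ 2) := by
    filter_upwards [hzero, (tendsto_add_atTop_nat 1).eventually hsupp] with N h0 hN
    have hstep : ∀ i, e (N + 1) i = if z i = 0 then 0 else
        (e N i - (1 / L) * ((Matrix.of D)ᵀ *ᵥ (Matrix.of D *ᵥ e N)) i) + δ N i := by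
      intro i
      simp only [he, istaJac]
      rw [jacStep_apply]
      by_cases hi : z i = 0
      · rw [if_pos ((hN i).2 hi), if_pos hi, lassoJac_eq_zero hi, sub_zero]
      · rw [if_neg fun h' => hi ((hN i).1 h'), if_neg hi]
        have h1 : ((Matrix.of D)ᵀ *ᵥ (Matrix.of D *ᵥ fun j => lassoJac y D l z j k)) i
            = - rowTerm y D l z i k := by
          rw [← gram_mul_lassoJac hunit hi, Matrix.mulVec_mulVec]; rfl
        have h2 : ((Matrix.of D)ᵀ *ᵥ (Matrix.of D *ᵥ fun j => istaJac y lam L l N D j k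
              - lassoJac y D l z j k)) i
            = ((Matrix.of D)ᵀ *ᵥ (Matrix.of D *ᵥ fun j => istaJac y lam L l N D j k)) i
              + rowTerm y D l z i k := by
          rw [← sub_neg_eq_add, ← h1, ← Pi.sub_apply, ← Matrix.mulVec_sub, ← Matrix.mulVec_sub]
          rfl
        rw [h2]
        simp only [hδ]
        ring
    calc Real.sqrt (∑ i, e (N + 1) i ^ 2)
        ≤ Real.sqrt (∑ i, ((e N i - (1 / L) * ((Matrix.of D)ᵀ *ᵥ (Matrix.of D *ᵥ e N)) i)
            + δ N i) ^ 2) := by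
          refine Real.sqrt_le_sqrt (Finset.sum_le_sum fun i _ => ?_)
          rw [hstep i]
          split_ifs
          · rw [zero_pow two_ne_zero]; positivity
          · exact le_rfl
      _ ≤ _ := (sqrt_sum_sq_add_le _ _).trans (by gcongr; exact hcontr _ h0)
  have hnorm := tendsto_zero_of_le_mul_add (a := fun N => Real.sqrt (∑ i, e N i ^ 2)) hq0 hq1
    (fun N => Real.sqrt_nonneg _) hδlim hrec
  have hi : Tendsto (fun N => e N i₀) atTop (𝓝 0) := by
    refine squeeze_zero_norm (fun N => ?_) hnorm
    refine Real.le_sqrt_of_sq_le ?_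
    rw [Real.norm_eq_abs, sq_abs]
    exact Finset.single_le_sum (f := fun i => e N i ^ 2) (fun _ _ => sq_nonneg _)
      (Finset.mem_univ i₀)
  simpa [he] using hi.add_const (lassoJac y D l z i₀ k)

end Convergence

/-! ### Second derivatives of the data-fitting term and the residual operator. -/

section Residual

variable {m n : ℕ} {y : Fin m → ℝ} {D : Dict m n} {z : Fin n → ℝ}

lemma deriv_half_sum_sq {ι : Type*} [Fintype ι] (a b : ι → ℝ) :
    deriv (fun s : ℝ => (1 / 2) * ∑ l, (a l + s * b l) ^ 2) 0 = ∑ l, a l * b l := by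
  have h : HasDerivAt (fun s : ℝ => (1 / 2) * ∑ l, (a l + s * b l) ^ 2)
      ((1 / 2) * ∑ l, ((2 : ℕ) * (a l + 0 * b l) ^ (2 - 1) * (1 * b l))) 0 :=
    (HasDerivAt.fun_sum fun l _ =>
      ((((hasDerivAt_id (0 : ℝ)).mul_const (b l)).const_add (a l)).fun_pow 2)).const_mul _
  rw [h.deriv, Finset.mul_sum]
  refine Finset.sum_congr rfl fun l _ => ?_
  push_cast
  ring

lemma dataFit_add_smul_single (y : Fin m → ℝ) (D : Dict m n) (w : Fin n → ℝ) (i : Fin n) (s : ℝ) :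
    dataFit y (w + s • Pi.single i 1) D
      = (1 / 2) * ∑ l, (((Matrix.of D *ᵥ w) l - y l) + s * D l i) ^ 2 := by
  rw [dataFit]
  congr 1
  refine Finset.sum_congr rfl fun l _ => ?_
  rw [Matrix.mulVec_add, Matrix.mulVec_smul]
  simp
  ring

lemma hess11_apply (i j : Fin n) : hess11 y z D i j = ∑ l, D l j * D l i := by
  have h : ∀ t : ℝ, deriv (fun s : ℝ =>
      dataFit y (z + t • Pi.single j 1 + s • Pi.single i 1) D) 0
      = ∑ l, ((Matrix.of D *ᵥ z) l - y l) * D l i + t * ∑ l, D l j * D l i := by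
    intro t
    simp only [dataFit_add_smul_single]
    rw [deriv_half_sum_sq, Finset.mul_sum, ← Finset.sum_add_distrib]
    refine Finset.sum_congr rfl fun l _ => ?_
    rw [Matrix.mulVec_add, Matrix.mulVec_smul]
    simp
    ring
  simp only [hess11, Matrix.of_apply, h]
  simp

lemma of_add_smul_single_mulVec (D : Dict m n) (l : Fin m) (k : Fin n) (s : ℝ) (w : Fin n → ℝ)
    (a : Fin m) :
    (Matrix.of (D + s • (Pi.single l (Pi.single k 1) : Dict m n)) *ᵥ w) a
      = (Matrix.of D *ᵥ w) a + s * if a = l then w k else 0 := by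
  simp only [Matrix.mulVec, dotProduct, Matrix.of_apply, Pi.add_apply, Pi.smul_apply, add_mul,
    Finset.sum_add_distrib, smul_eq_mul, mul_assoc, ← Finset.mul_sum]
  congr 2
  split_ifs with h
  · subst h
    simp [Pi.single_apply]
  · simp [h]

lemma hess21_apply (l : Fin m) (k j : Fin n) : hess21 y z D (l, k) j = rowTerm y D l z j k := by
  have h : ∀ t : ℝ, deriv (fun s : ℝ =>
      dataFit y (z + t • Pi.single j 1) (D + s • (Pi.single l (Pi.single k 1) : Dict m n))) 0
      = ((Matrix.of D *ᵥ z) l - y l + t * D l j) * (z k + t * if k = j then 1 else 0) := by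
    intro t
    have e : ∀ s : ℝ, dataFit y (z + t • Pi.single j 1)
        (D + s • (Pi.single l (Pi.single k 1) : Dict m n))
        = (1 / 2) * ∑ a, (((Matrix.of D *ᵥ (z + t • Pi.single j 1)) a - y a)
          + s * if a = l then (z + t • Pi.single j 1 : Fin n → ℝ) k else 0) ^ 2 := by
      intro s
      rw [dataFit]
      congr 1
      refine Finset.sum_congr rfl fun a _ => ?_
      rw [of_add_smul_single_mulVec]
      ring
    simp only [e]
    rw [deriv_half_sum_sq, Finset.sum_eq_single l (fun b _ hb => by simp [hb]) (by simp),
      if_pos rfl, Matrix.mulVec_add, Matrix.mulVec_smul]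
    simp [Pi.single_apply]
    left
    ring
  have h2 : HasDerivAt (fun t : ℝ => ((Matrix.of D *ᵥ z) l - y l + t * D l j)
      * (z k + t * if k = j then 1 else 0))
      ((1 * D l j) * (z k + 0 * if k = j then 1 else 0)
        + ((Matrix.of D *ᵥ z) l - y l + 0 * D l j) * (1 * if k = j then 1 else 0)) 0 :=
    (((hasDerivAt_id (0 : ℝ)).mul_const (D l j)).const_add _).fun_mul
      (((hasDerivAt_id (0 : ℝ)).mul_const _).const_add _)
  simp only [hess21, Matrix.of_apply, h]
  rw [h2.deriv, rowTerm_apply]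
  simp only [eq_comm (a := k)]
  split_ifs <;> simp [Matrix.mulVec, dotProduct]

/-- The entry `((l, k), j)` with `j` in the support is, by symmetry of `Dᵀ D`, the entry `(j, k)` of
`Dᵀ D J_l` plus the row term; `gram_mul_lassoJac` makes these cancel. The other columns are masked.
-/
theorem residualOp_lassoJac_eq_zero (h : IsUnit (supportGram D z)) :
    residualOp y z D (fun l => lassoJac y D l z) {i | z i ≠ 0} = 0 := by
  ext ⟨l, k⟩ j
  simp only [residualOp, Matrix.add_apply, Matrix.mul_apply, Matrix.transpose_apply, fullJac,
    maskCols, Matrix.of_apply, hess11_apply, hess21_apply, Matrix.zero_apply]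
  by_cases hj : z j = 0
  · simp [hj]
  · have := gram_mul_lassoJac (y := y) (l := l) h hj k
    rw [Set.indicator_of_mem (by exact hj)]
    have e : ((Matrix.of D)ᵀ * Matrix.of D * lassoJac y D l z) j k
        = ∑ i, lassoJac y D l z i k * ((∑ a, D a j * D a i) * 1) := by
      rw [Matrix.mul_apply]
      refine Finset.sum_congr rfl fun i _ => ?_
      rw [mul_one, mul_comm]
      rfl
    rw [mul_one, ← e, this, neg_add_cancel]

end Residual
-- Assembly of the theorem.
theorem mainTheorem1 (m n : ℕ) (y : Fin m → ℝ) (lam : ℝ) (hlam : 0 < lam)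
    (zs : Dict m n → Fin n → ℝ) (hzs : ∀ D, IsLassoSol y lam D (zs D)) :
    -- weak Jacobians of the iterates: the recursion
    (∀ L : ℝ, 0 < L → ∀ (N : ℕ) (l : Fin m),
      IsWeakJacobianOn (n := n) Set.univ (ista y lam L N) l (istaJac y lam L l N) ∧
      ∀ J J' : Dict m n → Matrix (Fin n) (Fin n) ℝ,
        IsWeakJacobianOn Set.univ (ista y lam L N) l J →
        IsWeakJacobianOn Set.univ (ista y lam L (N + 1)) l J' →
        ∀ᵐ D : Dict m n,
          J' D = jacStep y L D l (ista y lam L N D) (ista y lam L (N + 1) D) (J D)) ∧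
    -- the weak Jacobian of the Lasso solution
    (∀ᵐ D : Dict m n, D ∈ uniqueDomain n y lam) ∧
    (∀ D : Dict m n, (∃! z, IsLassoSol y lam D z) → IsUnit (supportGram D (zs D))) ∧
    (∀ l : Fin m,
      IsWeakJacobianOn (uniqueDomain n y lam) zs l (fun D => lassoJac y D l (zs D))) ∧
    -- convergence of the weak Jacobians
    (∀ L : ℝ, 0 < L → ∀ (l : Fin m) (J : ℕ → Dict m n → Matrix (Fin n) (Fin n) ℝ),
      (∀ N, IsWeakJacobianOn Set.univ (ista y lam L N) l (J N)) →
      ∀ᵐ D : Dict m n, specNorm D ^ 2 ≤ L →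
        Tendsto (fun N => J N D) atTop (𝓝 (lassoJac y D l (zs D)))) ∧
    (∀ᵐ D : Dict m n, ∀ L : ℝ, 0 < L → specNorm D ^ 2 ≤ L → ∀ l : Fin m,
      Tendsto (fun N => istaJac y lam L l N D) atTop (𝓝 (lassoJac y D l (zs D)))) ∧
    (∀ D : Dict m n, IsUnit (supportGram D (zs D)) →
      (∀ j, zs D j = 0 → |((Matrix.of D)ᵀ *ᵥ (y - Matrix.of D *ᵥ zs D)) j| < lam) →
      ∀ L : ℝ, 0 < L → specNorm D ^ 2 ≤ L → ∀ l : Fin m,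
        Tendsto (fun N => istaJac y lam L l N D) atTop (𝓝 (lassoJac y D l (zs D)))) ∧
    -- the residual operator vanishes
    (∀ D : Dict m n, IsUnit (supportGram D (zs D)) →
      residualOp y (zs D) D (fun l => lassoJac y D l (zs D)) {i | zs D i ≠ 0} = 0) := by

  have hnd : ∀ᵐ D : Dict m n, Nondegenerate y lam D (zs D) := by
    filter_upwards [ae_nondegenerate y hlam] with D hD using hD _ (hzs D)
  refine ⟨fun L hL N l => ⟨isWeakJacobianOn_ista y hlam hL N l, fun J J' hJ hJ' => ?_⟩, ?_,
    fun D hu => isUnit_supportGram_iff.2 fun c hc hDc =>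
      (hzs D).eq_zero_of_existsUnique hlam.le hu hc hDc,
    isWeakJacobianOn_lassoSol hlam hzs, fun L hL l J hJ => ?_, ?_,
    fun D hunit hlt L hL hspec l =>
      tendsto_istaJac hlam hL hspec (hzs D) ⟨isUnit_supportGram_iff.1 hunit, hlt⟩ l,
    fun D hunit => residualOp_lassoJac_eq_zero hunit⟩
  · filter_upwards [ae_eq_istaJac hlam hL hJ, ae_eq_istaJac hlam hL hJ'] with D h h'
    rw [h, h']
    rfl
  · filter_upwards [hnd] with D hD using hD.equiInjective.mem_uniqueDomain hlam hzs
  · filter_upwards [hnd, ae_all_iff.2 fun N => ae_eq_istaJac hlam hL (hJ N)] with D hD hJD hspec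
    simp only [hJD]
    exact tendsto_istaJac hlam hL hspec (hzs D) hD l
  · filter_upwards [hnd] with D hD L hL hspec l
    exact tendsto_istaJac hlam hL hspec (hzs D) hD l
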